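/- Let $V$ and $H$ be complex Hilbert spaces with $V$ continuously and densely embedded in $H$, let $V'$ be the antidual of $V$, and regard $V\subset H\subset V'$ as a Gelfand triple, $f\in H$ being identified with the functional $v\mapsto\langle f,v\rangle_H$ on $V$. Let $\mathcal E\colon V\times V\to\mathbb C$ be a continuous sesquilinear form that is coercive, i.e. there is $\mu>0$ with $\operatorname{Re}\mathcal E(v,v)\ge\mu\|v\|_V^2$ for all $v\in V$. Let $\mathcal A\colon V\to V'$ be given by $\langle\mathcal A u,v\rangle_{V',V}=\mathcal E(u,v)$, and let $A$ be the part of $\mathcal A$ in $H$, i.e. $D(A)=\{x\in V:\mathcal A x\in H\}$ and $Ax=\mathcal A x$. Let $0<s<1$ and let $A^s$ be the fractional power of $A$: it is the inverse of the injective bounded operator $$A^{-s}=\frac{\sin(\pi s)}{\pi}\int_0^\infty r^{-s}(r+A)^{-1}\,dr$$ on $H$, and $D(A^s)$ is the range of $A^{-s}$. For $0<\theta<1$ and Hilbert spaces $Y\subset X$ with continuous dense embedding, let $W_\theta(X,Y)$ be the space of all $u\in L^1_{\rm loc}((0,\infty);Y)$ which have a weak derivative $u'\in L^1_{\rm loc}((0,\infty);X)$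 and satisfy $t^{\theta}u\in L^2((0,\infty),\frac{dt}{t};Y)$ and $t^{\theta}u'\in L^2((0,\infty),\frac{dt}{t};X)$. Every $u\in W_\theta(X,Y)$ has a representative that is continuous from $(0,\infty)$ to $X$, and $u(0):=\lim_{t\downarrow0}u(t)$, taken along this representative, exists in $X$. A function $u\in W_{1-s}(H,V)$ is called $s$-harmonic if $t^{1-2s}u'\in W_s(V',H)$ and $$-(t^{1-2s}u')'(t)+t^{1-2s}\mathcal A u(t)=0\quad\text{in }V'\text{ for a.e. }t\in(0,\infty).$$ Its $s$-normal derivative is the limit $-\lim_{t\downarrow0}t^{1-2s}u'(t)$ in $V'$, which is $-w(0)$ for $w=t^{1-2s}u'\in W_s(V',H)$. Let $u$ be $s$-harmonic, let $x=u(0)\in H$, and let $y=-\lim_{t\downarrow0}t^{1-2s}u'(t)\in V'$ be its $s$-normal derivative. Then $$x\in D(A^s)\quad\text{if and only if}\quad y\in H.$$ -/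

import Mathlib

open MeasureTheory Set Filter Topology
open scoped ContDiff

noncomputable section

namespace FracDtN

section WeightedSobolev

variable {X Y : Type*} [NormedAddCommGroup X] [NormedSpace ℂ X]
  [NormedAddCommGroup Y] [NormedSpace ℂ Y]

/-- The measure `dt / t` on the half-line `(0, ∞)`. -/
def starMeasure : Measure ℝ :=
  (volume.restrict (Ioi (0 : ℝ))).withDensity (fun t => ENNReal.ofReal t⁻¹)

/-- The test functions: complex-valued `φ ∈ C_c^∞((0, ∞))`. -/
def IsTestFunction (φ : ℝ → ℂ) : Prop :=
  ContDiff ℝ ∞ φ ∧ HasCompactSupport φ ∧ tsupport φ ⊆ Ioi (0 : ℝ)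

/-- `v ∈ L¹_loc((0, ∞); X)` is the weak derivative of `u ∈ L¹_loc((0, ∞); X)`.
Only the values of the functions on `(0, ∞)` matter. -/
def IsWeakDeriv (u v : ℝ → X) : Prop :=
  LocallyIntegrableOn u (Ioi 0) ∧ LocallyIntegrableOn v (Ioi 0) ∧
    ∀ φ : ℝ → ℂ, IsTestFunction φ →
      -∫ t in Ioi (0 : ℝ), deriv φ t • u t = ∫ t in Ioi (0 : ℝ), φ t • v t

/-- `u ∈ W_s(X, Y)`, where `Y` is embedded in `X` through `ι`: `u ∈ L¹_loc((0, ∞); Y)` has a weak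
derivative `u' ∈ L¹_loc((0, ∞); X)`, `t ^ s u ∈ L²((0, ∞), dt / t; Y)` and
`t ^ s u' ∈ L²((0, ∞), dt / t; X)`. -/
def MemW (ι : Y →L[ℂ] X) (s : ℝ) (u : ℝ → Y) : Prop :=
  LocallyIntegrableOn u (Ioi 0) ∧
    MemLp (fun t => (t ^ s : ℝ) • u t) 2 starMeasure ∧
    ∃ u' : ℝ → X, IsWeakDeriv (fun t => ι (u t)) u' ∧
      MemLp (fun t => (t ^ s : ℝ) • u' t) 2 starMeasure

/-- `x = lim_{t ↓ 0} u(t)` in `X`, where the class `u` (of functions modulo equality almost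
everywhere on `(0, ∞)`) is evaluated through its representative that is continuous on `(0, ∞)`. -/
def IsTraceAtZero (u : ℝ → X) (x : X) : Prop :=
  ∃ c : ℝ → X, ContinuousOn c (Ioi 0) ∧ c =ᵐ[volume.restrict (Ioi (0 : ℝ))] u ∧
    Tendsto c (𝓝[>] 0) (𝓝 x)

end WeightedSobolev

section Operators

variable {H : Type*} [NormedAddCommGroup H] [NormedSpace ℂ H]

/-- `R` is the bounded everywhere defined inverse of the unbounded operator `B` in `H`. -/
def IsBoundedInverse (B : H →ₗ.[ℂ] H) (R : H →L[ℂ] H) : Prop :=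
  (∀ f : H, ∃ h : R f ∈ B.domain, B ⟨R f, h⟩ = f) ∧ ∀ x : B.domain, R (B x) = x

open Classical in
/-- The bounded inverse `B⁻¹` of an unbounded operator `B` in `H` (it is unique if it exists; the
value is `0` if there is none). -/
def boundedInverse (B : H →ₗ.[ℂ] H) : H →L[ℂ] H :=
  if h : ∃ R : H →L[ℂ] H, IsBoundedInverse B R then h.choose else 0

/-- The operator `r + A` with domain `D(A)`. -/
def shift (A : H →ₗ.[ℂ] H) (r : ℝ) : H →ₗ.[ℂ] H :=
  ((r : ℂ) • (LinearMap.id : H →ₗ[ℂ] H)) +ᵥ A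

/-- The negative fractional power, `A⁻ˢ = (sin (π s) / π) ∫₀^∞ r⁻ˢ (r + A)⁻¹ dr` for `0 < s < 1`
(Balakrishnan's formula, a Bochner integral in the space of bounded operators). -/
def negFracPow (A : H →ₗ.[ℂ] H) (s : ℝ) : H →L[ℂ] H :=
  (Real.sin (Real.pi * s) / Real.pi) •
    ∫ r in Ioi (0 : ℝ), (r ^ (-s) : ℝ) • boundedInverse (shift A r)

/-- The fractional power `Aˢ = (A⁻ˢ)⁻¹`, an unbounded operator whose domain `D(Aˢ)` is the range
of `A⁻ˢ`. -/
def fracPow (A : H →ₗ.[ℂ] H) (s : ℝ) : H →ₗ.[ℂ] H :=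
  ((negFracPow A s : H →ₗ[ℂ] H).toPMap ⊤).inverse

end Operators

section Forms

variable {V H : Type*} [NormedAddCommGroup V] [InnerProductSpace ℂ V]
  [NormedAddCommGroup H] [InnerProductSpace ℂ H]

/-- The antidual `V'` of `V`: continuous antilinear functionals with the dual norm. -/
abbrev Antidual (V : Type*) [NormedAddCommGroup V] [InnerProductSpace ℂ V] : Type _ :=
  V →L⋆[ℂ] ℂ

/-- The embedding of `H` in `V'` in the Gelfand triple `V ⊆ H ⊆ V'`: the vector `f` becomes the
functional `v ↦ ⟪f, v⟫_H` (inner product linear in `f` and antilinear in `v`; in Mathlib's order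
of arguments this is `inner ℂ (ι v) f`). -/
def toAntidual (ι : V →L[ℂ] H) : H →L[ℂ] Antidual V :=
  LinearMap.mkContinuous₂
    (LinearMap.mk₂'ₛₗ (RingHom.id ℂ) (starRingEnd ℂ) (fun (f : H) (v : V) => inner ℂ (ι v) f)
      (fun f g v => inner_add_right _ _ _)
      (fun c f v => by simp)
      (fun f v w => by simp)
      (fun c f v => by simp [mul_comm]))
    ‖ι‖
    (fun f v => by
      calc ‖inner ℂ (ι v) f‖ ≤ ‖ι v‖ * ‖f‖ := norm_inner_le_norm _ _
        _ ≤ (‖ι‖ * ‖v‖) * ‖f‖ := by gcongr; exact ι.le_opNorm v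
        _ = ‖ι‖ * ‖f‖ * ‖v‖ := by ring)

@[simp] theorem toAntidual_apply (ι : V →L[ℂ] H) (f : H) (v : V) :
    toAntidual ι f v = inner ℂ (ι v) f := rfl

/-- The graph of the part in `H` of an operator `𝒜 : V → V'`: the pairs `(x, f) ∈ H × H` with
`x ∈ V` and `𝒜 x = f` in `V'`. -/
def partGraph (ι : V →L[ℂ] H) (𝒜 : V →L[ℂ] Antidual V) : Submodule ℂ (H × H) where
  carrier := {p | ∃ u : V, ι u = p.1 ∧ 𝒜 u = toAntidual ι p.2}
  add_mem' := by
    rintro p q ⟨u, hu, hu'⟩ ⟨v, hv, hv'⟩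
    exact ⟨u + v, by simp [hu, hv], by simp [hu', hv']⟩
  zero_mem' := ⟨0, by simp, by simp⟩
  smul_mem' := by
    rintro c p ⟨u, hu, hu'⟩
    exact ⟨c • u, by simp [hu], by simp [hu']⟩

/-- The operator `A` in `H` associated with the form `ℰ`: the part in `H` of `𝒜 : V → V'`,
`⟨𝒜 u, v⟩ = ℰ(u, v)`. A continuous sesquilinear form (linear in its first argument, antilinear in
its second) is given in its curried version, so that `𝒜` is `ℰ` itself. -/
def formOperator (ι : V →L[ℂ] H) (ℰ : V →L[ℂ] Antidual V) : H →ₗ.[ℂ] H :=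
  (partGraph ι ℰ).toLinearPMap

/-- The form `ℰ` is coercive. -/
def Coercive (ℰ : V →L[ℂ] Antidual V) : Prop :=
  ∃ μ : ℝ, 0 < μ ∧ ∀ u : V, μ * ‖u‖ ^ 2 ≤ (ℰ u u).re

/-- `u` is `(ℰ, s)`-harmonic: `u ∈ W_{1-s}(H, V)`, `t ^ (1-2s) u' ∈ W_s(V', H)` and
`-(t ^ (1-2s) u')' + t ^ (1-2s) 𝒜 u = 0` in `V'` almost everywhere on `(0, ∞)`. -/
def IsHarmonic (ι : V →L[ℂ] H) (ℰ : V →L[ℂ] Antidual V) (s : ℝ) (u : ℝ → V) : Prop :=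
  MemW ι (1 - s) u ∧
    ∃ u' : ℝ → H, IsWeakDeriv (fun t => ι (u t)) u' ∧
      MemW (toAntidual ι) s (fun t => (t ^ (1 - 2 * s) : ℝ) • u' t) ∧
      ∃ w' : ℝ → Antidual V,
        IsWeakDeriv (fun t => toAntidual ι ((t ^ (1 - 2 * s) : ℝ) • u' t)) w' ∧
        ∀ᵐ t ∂(volume.restrict (Ioi (0 : ℝ))), -w' t + (t ^ (1 - 2 * s) : ℝ) • ℰ (u t) = 0

/-- `y = -lim_{t ↓ 0} t ^ (1-2s) u'(t)` in `V'`, the `s`-normal derivative of `u`. -/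
def IsNormalDeriv (ι : V →L[ℂ] H) (s : ℝ) (u : ℝ → V) (y : Antidual V) : Prop :=
  ∃ u' : ℝ → H, IsWeakDeriv (fun t => ι (u t)) u' ∧
    IsTraceAtZero (fun t => -toAntidual ι ((t ^ (1 - 2 * s) : ℝ) • u' t)) y

end Forms

end FracDtN

end

/-!
The inverse of the operator `A` of the form is a bounded operator `T` on `H`, and coercivity makes
it strictly accretive: `δ ‖T f‖² ≤ Re ⟪T f, f⟫`. As `𝒜⁻¹ : V' → V ⊆ H` is injective, everything can
be moved into `H`: with `η = 𝒜⁻¹ y`, the condition `y ∈ H` means that `η` lies in the range of `T`.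
The theorem follows from the identity `k T x = A⁻ˢ η` with a constant `k > 0`
(`IsHarmonic.smul_apply_trace_eq`), from the fact that `A⁻ˢ` commutes with `T`, and from the
injectivity of `A⁻ˢ` (`balakrishnan_injective`). The latter is elementary: up to a positive factor,
the real part of `⟪A⁻ˢ f, f⟫` is the integral of `r⁻ˢ Re ⟪(r + A)⁻¹ f, f⟫`, and the integrand is
positive unless `f = 0`.

For the identity, the harmonic function `u` is integrated against the heat kernel of the operator
`t ^ (2s-1) ∂ₜ t ^ (1-2s) ∂ₜ`:
`v(r) = r ^ (s-1) ∫₀^∞ t ^ (1-2s) e^(-t²/(4r)) u(t) dt` (`heatTransform`). Two integrations by parts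
turn the equation for `u` into `T v' = v - r ^ (s-1) η` (`apply_deriv_heatTransform`). Moreover `v`
is bounded at infinity, and `v(r)` tends to a multiple of `x` as `r ↓ 0` (`tendsto_heatTransform`).
The same equation has an explicit solution built from resolvents only, namely
`Γ(1-s)⁻¹ ∫₀^∞ ρ⁻ˢ e^(-rρ) (1 + ρ T)⁻¹ η dρ` (`dampedLaplace`). The difference `d` of two solutions
bounded at infinity satisfies `T d' = d`; accretivity makes `‖d‖² e^(-2δr)` nondecreasing, so that
`d = 0` (`eq_zero_of_hasDerivAt_of_bounded`). Applying `T` to the explicit solution and letting `r ↓ 0`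
produces Balakrishnan's integral for `A⁻ˢ η`, up to a constant factor. This route needs neither the semigroup generated by
`-A` nor a functional calculus.
-/

namespace FracDtN

/-! ### Accretive operators -/

section Accretive

variable {H : Type*} [NormedAddCommGroup H] [InnerProductSpace ℂ H] [CompleteSpace H]

/-- The Lax–Milgram lemma for a coercive bounded operator on a complex Hilbert space. -/
theorem exists_inverse_of_coercive (B : H →L[ℂ] H) {μ : ℝ} (hμ : 0 < μ)
    (hB : ∀ v, μ * ‖v‖ ^ 2 ≤ (inner ℂ (B v) v).re) :
    ∃ R : H →L[ℂ] H, (∀ f, B (R f) = f) ∧ ∀ f, R (B f) = f := by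
  have hlow : ∀ v, ‖v‖ ≤ μ⁻¹ * ‖B v‖ := fun v => by
    rcases eq_or_ne v 0 with rfl | hv
    · simp
    have h1 : μ * ‖v‖ ^ 2 ≤ ‖B v‖ * ‖v‖ :=
      (hB v).trans ((Complex.re_le_norm _).trans (norm_inner_le_norm _ _))
    have hv' : 0 < ‖v‖ := norm_pos_iff.2 hv
    rw [inv_mul_eq_div, le_div_iff₀ hμ]
    nlinarith
  have hanti : AntilipschitzWith (Real.toNNReal μ⁻¹) B :=
    ContinuousLinearMap.antilipschitz_of_bound B fun v => by
      rw [Real.coe_toNNReal _ (inv_pos.2 hμ).le]; exact hlow v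
  have hker : B.ker = ⊥ := LinearMap.ker_eq_bot.2 hanti.injective
  have hclosed : IsClosed (B.range : Set H) := by
    exact hanti.isClosed_range B.uniformContinuous
  -- the range is closed, and coercivity leaves no room for a vector orthogonal to it
  have hrange : B.range = ⊤ := by
    have := hclosed.completeSpace_coe
    rw [← Submodule.orthogonal_orthogonal B.range, Submodule.eq_top_iff']
    intro v w hw
    have h0 : inner ℂ (B w) w = 0 := hw _ (LinearMap.mem_range_self _ w)
    have h1 := hB w
    rw [h0] at h1
    have : ‖w‖ ^ 2 = 0 := le_antisymm (by
      have h2 : μ * ‖w‖ ^ 2 ≤ 0 := by simpa using h1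
      nlinarith [sq_nonneg ‖w‖]) (sq_nonneg _)
    have : w = 0 := by simpa using this
    simp [this]
  let e := ContinuousLinearEquiv.ofBijective B hker hrange
  exact ⟨e.symm, fun f => e.apply_symm_apply f, fun f => e.symm_apply_apply f⟩

/-- The operator `(1 + ρ T)⁻¹`. When `T = A⁻¹` it equals `A (ρ + A)⁻¹`.
It is used for accretive `T` and `ρ ≥ 0` only, where `1 + ρ T` is invertible. -/
noncomputable def dampedInverse (T : H →L[ℂ] H) (ρ : ℝ) : H →L[ℂ] H :=
  Ring.inverse (1 + ρ • T)

variable {T : H →L[ℂ] H} {δ : ℝ}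

theorem isUnit_one_add_smul (hacc : ∀ f, 0 ≤ (inner ℂ (T f) f).re) {ρ : ℝ} (hρ : 0 ≤ ρ) :
    IsUnit (1 + ρ • T) := by
  obtain ⟨R, h1, h2⟩ := exists_inverse_of_coercive (1 + ρ • T) one_pos (fun v => by
    have h := mul_nonneg hρ (hacc v)
    have h' : (inner ℂ v v : ℂ).re = ‖v‖ ^ 2 := inner_self_eq_norm_sq (𝕜 := ℂ) v
    simp [inner_smul_left_eq_smul, h', h, -inner_self_eq_norm_sq_to_K])
  exact ⟨⟨_, R, ContinuousLinearMap.ext h1, ContinuousLinearMap.ext h2⟩, rfl⟩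

theorem dampedInverse_add (hacc : ∀ f, 0 ≤ (inner ℂ (T f) f).re) {ρ : ℝ} (hρ : 0 ≤ ρ) (f : H) :
    dampedInverse T ρ f + ρ • T (dampedInverse T ρ f) = f :=
  DFunLike.congr_fun (Ring.mul_inverse_cancel _ (isUnit_one_add_smul hacc hρ)) f

theorem dampedInverse_apply_add (hacc : ∀ f, 0 ≤ (inner ℂ (T f) f).re) {ρ : ℝ} (hρ : 0 ≤ ρ)
    (f : H) : dampedInverse T ρ (f + ρ • T f) = f :=
  DFunLike.congr_fun (Ring.inverse_mul_cancel _ (isUnit_one_add_smul hacc hρ)) f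

theorem norm_dampedInverse_le (hacc : ∀ f, 0 ≤ (inner ℂ (T f) f).re) {ρ : ℝ} (hρ : 0 ≤ ρ) :
    ‖dampedInverse T ρ‖ ≤ 1 := by
  refine ContinuousLinearMap.opNorm_le_bound _ zero_le_one fun f => ?_
  set g := dampedInverse T ρ f with hg
  have hfg : g + ρ • T g = f := dampedInverse_add hacc hρ f
  have h := mul_nonneg hρ (hacc g)
  have h' : (inner ℂ g g : ℂ).re = ‖g‖ ^ 2 := inner_self_eq_norm_sq (𝕜 := ℂ) g
  have h1 : ‖g‖ ^ 2 ≤ (inner ℂ f g : ℂ).re := by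
    rw [← hfg]
    simp [inner_smul_left_eq_smul, h', h, -inner_self_eq_norm_sq_to_K]
  have h2 := h1.trans ((Complex.re_le_norm _).trans (norm_inner_le_norm (𝕜 := ℂ) f g))
  rcases (norm_nonneg g).eq_or_lt with h0 | h0
  · rw [← h0]; positivity
  · nlinarith

theorem continuousOn_dampedInverse (hacc : ∀ f, 0 ≤ (inner ℂ (T f) f).re) :
    ContinuousOn (dampedInverse T) (Ici 0) := fun ρ hρ => by
  obtain ⟨U, hU⟩ := isUnit_one_add_smul hacc hρ
  have h := NormedRing.inverse_continuousAt U
  rw [hU] at h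
  exact (ContinuousAt.comp (f := fun ρ : ℝ => 1 + ρ • T) h (by fun_prop)).continuousWithinAt

theorem norm_comp_dampedInverse_le (hacc : ∀ f, 0 ≤ (inner ℂ (T f) f).re) {ρ : ℝ} (hρ : 0 ≤ ρ) :
    ‖T ∘L dampedInverse T ρ‖ ≤ ‖T‖ := by
  refine (ContinuousLinearMap.opNorm_comp_le _ _).trans ?_
  exact mul_le_of_le_one_right (norm_nonneg _) (norm_dampedInverse_le hacc hρ)

/-- The decay at infinity comes from `ρ T (1 + ρ T)⁻¹ = 1 - (1 + ρ T)⁻¹`. -/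
theorem norm_comp_dampedInverse_le_div (hacc : ∀ f, 0 ≤ (inner ℂ (T f) f).re) {ρ : ℝ}
    (hρ : 0 < ρ) : ‖T ∘L dampedInverse T ρ‖ ≤ 2 / ρ := by
  refine ContinuousLinearMap.opNorm_le_bound _ (by positivity) fun f => ?_
  have h := dampedInverse_add hacc hρ.le f
  have h1 : ρ • T (dampedInverse T ρ f) = f - dampedInverse T ρ f := eq_sub_of_add_eq' h
  have h2 : ‖dampedInverse T ρ f‖ ≤ ‖f‖ := by
    simpa using (dampedInverse T ρ).le_of_opNorm_le (norm_dampedInverse_le hacc hρ.le) f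
  have h3 : ρ * ‖T (dampedInverse T ρ f)‖ ≤ 2 * ‖f‖ := by
    have h3 : ρ * ‖T (dampedInverse T ρ f)‖ = ‖ρ • T (dampedInverse T ρ f)‖ := by
      rw [norm_smul, Real.norm_of_nonneg hρ.le]
    rw [h3, h1]
    linarith [norm_sub_le f (dampedInverse T ρ f)]
  rw [ContinuousLinearMap.comp_apply, div_mul_eq_mul_div, le_div_iff₀ hρ]
  linarith

variable {s : ℝ}

theorem integrableOn_rpow_smul_comp_dampedInverse (hacc : ∀ f, 0 ≤ (inner ℂ (T f) f).re)
    (hs0 : 0 < s) (hs1 : s < 1) :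
    IntegrableOn (fun ρ : ℝ => ρ ^ (-s) • (T ∘L dampedInverse T ρ)) (Ioi 0) := by
  have hmeas : ContinuousOn (fun ρ : ℝ => ρ ^ (-s) • (T ∘L dampedInverse T ρ)) (Ioi 0) := by
    have hpow : ContinuousOn (fun ρ : ℝ => ρ ^ (-s)) (Ioi 0) := fun ρ hρ =>
      (Real.continuousAt_rpow_const _ _ (Or.inl (ne_of_gt hρ))).continuousWithinAt
    refine hpow.smul ?_
    · exact continuousOn_const.clm_comp
        ((continuousOn_dampedInverse hacc).mono Ioi_subset_Ici_self)
  rw [← Ioc_union_Ioi_eq_Ioi zero_le_one]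
  refine IntegrableOn.union ?_ ?_
  · have hint : IntegrableOn (fun ρ : ℝ => ρ ^ (-s) * ‖T‖) (Ioc 0 1) := by
      refine Integrable.mul_const ?_ _
      exact (intervalIntegrable_iff_integrableOn_Ioc_of_le zero_le_one).1
        (intervalIntegral.intervalIntegrable_rpow' (by linarith))
    refine hint.mono' ((hmeas.mono Ioc_subset_Ioi_self).aestronglyMeasurable
      measurableSet_Ioc) ?_
    filter_upwards [ae_restrict_mem measurableSet_Ioc] with ρ hρ
    rw [norm_smul, Real.norm_of_nonneg (Real.rpow_nonneg hρ.1.le _)]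
    exact mul_le_mul_of_nonneg_left (norm_comp_dampedInverse_le hacc hρ.1.le)
      (Real.rpow_nonneg hρ.1.le _)
  · have hint : IntegrableOn (fun ρ : ℝ => 2 * ρ ^ (-s - 1)) (Ioi 1) :=
      (integrableOn_Ioi_rpow_of_lt (by linarith) one_pos).const_mul _
    refine hint.mono' ((hmeas.mono (Ioi_subset_Ioi zero_le_one)).aestronglyMeasurable
      measurableSet_Ioi) ?_
    filter_upwards [ae_restrict_mem measurableSet_Ioi] with ρ hρ
    have hρ0 : (0 : ℝ) < ρ := one_pos.trans hρ
    rw [norm_smul, Real.norm_of_nonneg (Real.rpow_nonneg hρ0.le _), Real.rpow_sub_one hρ0.ne']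
    refine (mul_le_mul_of_nonneg_left (norm_comp_dampedInverse_le_div hacc hρ0)
      (Real.rpow_nonneg hρ0.le _)).trans_eq ?_
    ring

/-- The operator `∫₀^∞ ρ⁻ˢ T (1 + ρ T)⁻¹ dρ`, a positive multiple of `Tˢ`. -/
noncomputable def balakrishnan (T : H →L[ℂ] H) (s : ℝ) : H →L[ℂ] H :=
  ∫ ρ in Ioi (0 : ℝ), ρ ^ (-s) • (T ∘L dampedInverse T ρ)

theorem balakrishnan_apply (hacc : ∀ f, 0 ≤ (inner ℂ (T f) f).re) (hs0 : 0 < s) (hs1 : s < 1)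
    (f : H) : balakrishnan T s f = ∫ ρ in Ioi (0 : ℝ), ρ ^ (-s) • T (dampedInverse T ρ f) := by
  rw [balakrishnan, ContinuousLinearMap.integral_apply
    (integrableOn_rpow_smul_comp_dampedInverse hacc hs0 hs1)]
  rfl

theorem comp_dampedInverse_comm (hacc : ∀ f, 0 ≤ (inner ℂ (T f) f).re) {ρ : ℝ} (hρ : 0 ≤ ρ)
    (f : H) : dampedInverse T ρ (T f) = T (dampedInverse T ρ f) := by
  conv_lhs => rw [← dampedInverse_add hacc hρ f, map_add,
    ContinuousLinearMap.map_smul_of_tower]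
  exact dampedInverse_apply_add hacc hρ _

theorem balakrishnan_comm (hacc : ∀ f, 0 ≤ (inner ℂ (T f) f).re) (hs0 : 0 < s) (hs1 : s < 1)
    (f : H) : balakrishnan T s (T f) = T (balakrishnan T s f) := by
  rw [balakrishnan_apply hacc hs0 hs1, balakrishnan_apply hacc hs0 hs1,
    ← ContinuousLinearMap.integral_comp_comm]
  · refine setIntegral_congr_fun measurableSet_Ioi fun ρ hρ => ?_
    simp only [comp_dampedInverse_comm hacc (le_of_lt hρ),
      ContinuousLinearMap.map_smul_of_tower]
  · exact (integrableOn_rpow_smul_comp_dampedInverse hacc hs0 hs1).apply_continuousLinearMap f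

/-- Taking the real part of the inner product of `∫₀^∞ ρ⁻ˢ T (1 + ρ T)⁻¹ f dρ` with `f`, one obtains
the integral of a nonnegative function which vanishes only if `f` does. -/
theorem balakrishnan_injective (hδ : 0 < δ) (hT : ∀ f, δ * ‖T f‖ ^ 2 ≤ (inner ℂ (T f) f).re)
    (hinj : Function.Injective T) (hs0 : 0 < s) (hs1 : s < 1) :
    Function.Injective (balakrishnan T s) := by
  have hacc : ∀ f, 0 ≤ (inner ℂ (T f) f).re := fun f => (by positivity : (0 : ℝ) ≤ _).trans (hT f)
  rw [injective_iff_map_eq_zero]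
  intro f hf
  have hint := (integrableOn_rpow_smul_comp_dampedInverse hacc hs0 hs1).apply_continuousLinearMap f
  have hpos : ∀ ρ : ℝ, 0 < ρ → ρ ^ (-s) * (δ * ‖T (dampedInverse T ρ f)‖ ^ 2) ≤
      (inner ℂ f ((ρ ^ (-s) • (T ∘L dampedInverse T ρ)) f)).re := fun ρ hρ => by
    set g := dampedInverse T ρ f with hg
    have hfg : g + ρ • T g = f := dampedInverse_add hacc hρ.le f
    have h1 : (inner ℂ f (T g)).re = (inner ℂ (T g) g).re + ρ * ‖T g‖ ^ 2 := by
      have h' : (inner ℂ (T g) (T g) : ℂ).re = ‖T g‖ ^ 2 := inner_self_eq_norm_sq (𝕜 := ℂ) _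
      have h'' : (inner ℂ g (T g) : ℂ).re = (inner ℂ (T g) g : ℂ).re := inner_re_symm (𝕜 := ℂ) _ _
      rw [← hfg]
      simp [inner_smul_left_eq_smul, h', h'', -inner_self_eq_norm_sq_to_K]
    have h2 : (inner ℂ f ((ρ ^ (-s) • (T ∘L dampedInverse T ρ)) f)).re
        = ρ ^ (-s) * (inner ℂ f (T g)).re := by
      simp [inner_smul_right_eq_smul, hg]
    rw [h2, h1]
    have := hT g
    have hp := Real.rpow_nonneg hρ.le (-s)
    gcongr
    nlinarith [mul_nonneg hρ.le (sq_nonneg ‖T g‖)]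
  have hzero : ∫ ρ in Ioi (0 : ℝ), (inner ℂ f ((ρ ^ (-s) • (T ∘L dampedInverse T ρ)) f)).re = 0 := by
    have h1 := integral_inner (𝕜 := ℂ) hint f
    rw [← ContinuousLinearMap.integral_apply
      (integrableOn_rpow_smul_comp_dampedInverse hacc hs0 hs1)] at h1
    change _ = inner ℂ f (balakrishnan T s f) at h1
    rw [hf, inner_zero_right] at h1
    have h2 := integral_re (𝕜 := ℂ) (hint.const_inner f)
    rw [h1] at h2
    exact h2.trans (by simp)
  have hae := (setIntegral_eq_zero_iff_of_nonneg_ae (f := fun ρ : ℝ =>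
    (inner ℂ f ((ρ ^ (-s) • (T ∘L dampedInverse T ρ)) f)).re) (by
      filter_upwards [ae_restrict_mem measurableSet_Ioi] with ρ hρ
      refine le_trans ?_ (hpos ρ hρ)
      have := Real.rpow_nonneg (le_of_lt hρ) (-s)
      positivity) (hint.const_inner (𝕜 := ℂ) f).re).1 hzero
  -- the integrand vanishes almost everywhere, hence at some `ρ > 0`, and one such `ρ` suffices
  have hne : (ae (volume.restrict (Ioi (0 : ℝ)))).NeBot := by
    rw [ae_neBot, Ne, Measure.restrict_eq_zero]; simp
  obtain ⟨ρ, h0, hρ⟩ := (hae.and (ae_restrict_mem measurableSet_Ioi)).exists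
  rw [mem_Ioi] at hρ
  have h1 := hpos ρ hρ
  simp only [Pi.zero_apply] at h0
  rw [h0] at h1
  have hp := Real.rpow_pos_of_pos hρ (-s)
  have h2 : ‖T (dampedInverse T ρ f)‖ ^ 2 ≤ 0 := by
    by_contra! h
    exact absurd h1 (not_le.2 (by simpa using by positivity))
  have h3 : T (dampedInverse T ρ f) = 0 := by
    have : ‖T (dampedInverse T ρ f)‖ = 0 := by nlinarith [norm_nonneg (T (dampedInverse T ρ f))]
    simpa using this
  have h4 : dampedInverse T ρ f = 0 := hinj (by rw [h3, map_zero])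
  have := dampedInverse_add hacc hρ.le f
  simpa [h4] using this.symm

end Accretive

/-! ### The first-order equation `T v' = v - r ^ (s-1) η` -/

section FirstOrder

variable {H : Type*} [NormedAddCommGroup H] [InnerProductSpace ℂ H]
  {T : H →L[ℂ] H} {δ s : ℝ}

/-- A solution of `T d' = d` which is bounded at infinity vanishes: accretivity of `T` makes
`‖d‖² e^(-2δr)` nondecreasing, while it tends to zero at infinity. -/
theorem eq_zero_of_hasDerivAt_of_bounded (hδ : 0 < δ)
    (hT : ∀ f, δ * ‖T f‖ ^ 2 ≤ (inner ℂ (T f) f).re) 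
    {d d' : ℝ → H}
    (hd : ∀ r, 0 < r → HasDerivAt d (d' r) r) (hTd : ∀ r, 0 < r → T (d' r) = d r) {C : ℝ}
    (hC : ∀ r, 1 ≤ r → ‖d r‖ ≤ C) {r : ℝ} (hr : 0 < r) : d r = 0 := by
  let : InnerProductSpace ℝ H := InnerProductSpace.complexToReal
  set h : ℝ → ℝ := fun r => ‖d r‖ ^ 2 * Real.exp (-(2 * δ) * r) with hh
  have hder : ∀ r, 0 < r → HasDerivAt h
      (2 * inner ℝ (d r) (d' r) * Real.exp (-(2 * δ) * r) +
        ‖d r‖ ^ 2 * (Real.exp (-(2 * δ) * r) * (-(2 * δ) * 1))) r := fun r hr =>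
    ((hd r hr).norm_sq).mul (((hasDerivAt_id r).const_mul (-(2 * δ))).exp)
  have hmono : MonotoneOn h (Ioi 0) := by
    refine monotoneOn_of_deriv_nonneg (convex_Ioi 0)
      (fun r hr => (hder r hr).continuousAt.continuousWithinAt)
      (fun r hr => (hder r (by simpa using hr)).differentiableAt.differentiableWithinAt)
      fun r hr => ?_
    rw [interior_Ioi] at hr
    rw [(hder r hr).deriv]
    have h1 := hT (d' r)
    rw [hTd r hr] at h1
    have h2 : inner ℝ (d r) (d' r) = (inner ℂ (d r) (d' r)).re := rfl
    rw [h2]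
    have := Real.exp_pos (-(2 * δ) * r)
    nlinarith
  have hlim : Tendsto (fun r => C ^ 2 * Real.exp (-(2 * δ) * r)) atTop (𝓝 0) := by
    have : Tendsto (fun r => -(2 * δ) * r) atTop atBot :=
      tendsto_id.const_mul_atTop_of_neg (by linarith)
    simpa using (Real.tendsto_exp_atBot.comp this).const_mul (C ^ 2)
  have hle : h r ≤ 0 := by
    refine ge_of_tendsto hlim ?_
    filter_upwards [eventually_ge_atTop (max r 1)] with R hR
    refine (hmono hr (hr.trans_le ((le_max_left _ _).trans hR))
      ((le_max_left _ _).trans hR)).trans ?_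
    have := hC R ((le_max_right _ _).trans hR)
    simp only [hh]
    gcongr
  have : ‖d r‖ ^ 2 ≤ 0 := by
    by_contra! h0
    exact absurd hle (not_le.2 (by positivity))
  have : ‖d r‖ = 0 := by nlinarith [norm_nonneg (d r)]
  simpa using this

variable [CompleteSpace H]

theorem integrableOn_rpow_mul_exp_smul_dampedInverse
    (hacc : ∀ f, 0 ≤ (inner ℂ (T f) f).re) {a r : ℝ} (ha : -1 < a) (hr : 0 < r) (η : H) :
    IntegrableOn (fun ρ : ℝ => (ρ ^ a * Real.exp (-r * ρ)) • dampedInverse T ρ η) (Ioi 0) := by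
  have hint : IntegrableOn (fun ρ : ℝ => ρ ^ a * Real.exp (-r * ρ) * ‖η‖) (Ioi 0) := by
    have := integrableOn_rpow_mul_exp_neg_mul_rpow ha one_pos hr
    simp only [Real.rpow_one] at this
    exact this.mul_const _
  have hmeas : ContinuousOn
      (fun ρ : ℝ => (ρ ^ a * Real.exp (-r * ρ)) • dampedInverse T ρ η) (Ioi 0) := by
    have hpow : ContinuousOn (fun ρ : ℝ => ρ ^ a * Real.exp (-r * ρ)) (Ioi 0) := fun ρ hρ =>
      ((Real.continuousAt_rpow_const _ _ (Or.inl (ne_of_gt hρ))).mul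
        (by fun_prop)).continuousWithinAt
    exact hpow.smul (((continuousOn_dampedInverse hacc).mono Ioi_subset_Ici_self).clm_apply
      continuousOn_const)
  refine hint.mono' (hmeas.aestronglyMeasurable measurableSet_Ioi) ?_
  filter_upwards [ae_restrict_mem measurableSet_Ioi] with ρ hρ
  rw [mem_Ioi] at hρ
  rw [norm_smul, Real.norm_of_nonneg (by positivity)]
  refine mul_le_mul_of_nonneg_left ?_ (by positivity)
  simpa using (dampedInverse T ρ).le_of_opNorm_le (norm_dampedInverse_le hacc hρ.le) η

/-- The Laplace transform of `ρ⁻ˢ (1 + ρ T)⁻¹ η`. -/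
noncomputable def dampedLaplace (T : H →L[ℂ] H) (s : ℝ) (η : H) (r : ℝ) : H :=
  ∫ ρ in Ioi (0 : ℝ), (ρ ^ (-s) * Real.exp (-r * ρ)) • dampedInverse T ρ η

theorem norm_dampedLaplace_le (hacc : ∀ f, 0 ≤ (inner ℂ (T f) f).re) (hs1 : s < 1) {r : ℝ}
    (hr : 0 < r) (η : H) :
    ‖dampedLaplace T s η r‖ ≤ r ^ (s - 1) * Real.Gamma (1 - s) * ‖η‖ := by
  have hg := Real.integral_rpow_mul_exp_neg_mul_Ioi (a := 1 - s) (by linarith) hr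
  have hrp : (1 / r) ^ (1 - s) = r ^ (s - 1) := by
    rw [one_div, Real.inv_rpow hr.le, ← Real.rpow_neg hr.le]; ring_nf
  rw [hrp] at hg
  rw [← hg, ← integral_mul_const]
  have hint := integrableOn_rpow_mul_exp_neg_mul_rpow (s := -s) (by linarith) one_pos hr
  simp only [Real.rpow_one] at hint
  refine norm_integral_le_of_norm_le ?_ ?_
  · refine IntegrableOn.congr_fun (hint.mul_const ‖η‖) (fun ρ _ => ?_) measurableSet_Ioi
    simp only [neg_mul]; ring_nf
  · filter_upwards [ae_restrict_mem measurableSet_Ioi] with ρ hρ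
    rw [mem_Ioi] at hρ
    rw [norm_smul, Real.norm_of_nonneg (by positivity)]
    have h := (dampedInverse T ρ).le_of_opNorm_le (norm_dampedInverse_le hacc hρ.le) η
    rw [one_mul] at h
    have e : ρ ^ (1 - s - 1) * Real.exp (-(r * ρ)) = ρ ^ (-s) * Real.exp (-r * ρ) := by ring_nf
    rw [e]
    exact mul_le_mul_of_nonneg_left h (by positivity)

theorem hasDerivAt_dampedLaplace (hacc : ∀ f, 0 ≤ (inner ℂ (T f) f).re) (hs1 : s < 1) {r : ℝ}
    (hr : 0 < r) (η : H) :
    HasDerivAt (dampedLaplace T s η)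
      (-∫ ρ in Ioi (0 : ℝ), (ρ ^ (1 - s) * Real.exp (-r * ρ)) • dampedInverse T ρ η) r := by
  have hint : IntegrableOn (fun ρ : ℝ => ρ ^ (1 - s) * Real.exp (-(r / 2) * ρ) * ‖η‖) (Ioi 0) := by
    have := integrableOn_rpow_mul_exp_neg_mul_rpow (s := 1 - s) (by linarith) one_pos (half_pos hr)
    simp only [Real.rpow_one] at this
    exact this.mul_const _
  have hnhds : Ioi (r / 2) ∈ 𝓝 r := Ioi_mem_nhds (by linarith)
  have h := hasDerivAt_integral_of_dominated_loc_of_deriv_le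
    (μ := volume.restrict (Ioi (0 : ℝ))) (s := Ioi (r / 2)) (x₀ := r)
    (F := fun r ρ => (ρ ^ (-s) * Real.exp (-r * ρ)) • dampedInverse T ρ η)
    (F' := fun r ρ => -((ρ ^ (1 - s) * Real.exp (-r * ρ)) • dampedInverse T ρ η))
    hnhds
    (by
      filter_upwards [hnhds] with x hx
      exact (integrableOn_rpow_mul_exp_smul_dampedInverse hacc (by linarith)
        ((half_pos hr).trans hx) η).aestronglyMeasurable)
    (integrableOn_rpow_mul_exp_smul_dampedInverse hacc (by linarith) hr η)
    (integrableOn_rpow_mul_exp_smul_dampedInverse hacc (by linarith) hr η).aestronglyMeasurable.neg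
    (by
      filter_upwards [ae_restrict_mem measurableSet_Ioi] with ρ hρ x hx
      rw [mem_Ioi] at hρ hx
      rw [norm_neg, norm_smul, Real.norm_of_nonneg (by positivity)]
      have h := (dampedInverse T ρ).le_of_opNorm_le (norm_dampedInverse_le hacc hρ.le) η
      rw [one_mul] at h
      gcongr)
    hint
    (by
      filter_upwards [ae_restrict_mem measurableSet_Ioi] with ρ hρ x _
      rw [mem_Ioi] at hρ
      have h1 : HasDerivAt (fun r : ℝ => ρ ^ (-s) * Real.exp (-r * ρ))
          (ρ ^ (-s) * (Real.exp (-x * ρ) * (-1 * ρ))) x :=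
        (((hasDerivAt_id x).neg.mul_const ρ).exp).const_mul _
      have h2 := h1.smul_const (dampedInverse T ρ η)
      refine h2.congr_deriv ?_
      rw [← neg_smul]
      congr 1
      rw [show 1 - s = -s + 1 by ring, Real.rpow_add_one hρ.ne']
      ring)
  have h2 := h.2
  rw [integral_neg] at h2
  exact h2

/-- The explicit solution: `dampedLaplace T s η` satisfies `T w' = w - Γ(1-s) r ^ (s-1) η`,
because `ρ T (1 + ρ T)⁻¹ = 1 - (1 + ρ T)⁻¹`. -/
theorem apply_deriv_dampedLaplace (hacc : ∀ f, 0 ≤ (inner ℂ (T f) f).re) (hs1 : s < 1) {r : ℝ}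
    (hr : 0 < r) (η : H) :
    T (-∫ ρ in Ioi (0 : ℝ), (ρ ^ (1 - s) * Real.exp (-r * ρ)) • dampedInverse T ρ η) =
      dampedLaplace T s η r - (Real.Gamma (1 - s) * r ^ (s - 1)) • η := by
  have hg := Real.integral_rpow_mul_exp_neg_mul_Ioi (a := 1 - s) (by linarith) hr
  have hrp : (1 / r) ^ (1 - s) = r ^ (s - 1) := by
    rw [one_div, Real.inv_rpow hr.le, ← Real.rpow_neg hr.le]; ring_nf
  rw [hrp, mul_comm] at hg
  have hint := integrableOn_rpow_mul_exp_neg_mul_rpow (s := -s) (by linarith) one_pos hr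
  simp only [Real.rpow_one] at hint
  have e : ∀ ρ : ℝ, ρ ^ (1 - s - 1) * Real.exp (-(r * ρ)) = ρ ^ (-s) * Real.exp (-r * ρ) :=
    fun ρ => by ring_nf
  simp only [e] at hg
  rw [map_neg, ← ContinuousLinearMap.integral_comp_comm _
    (integrableOn_rpow_mul_exp_smul_dampedInverse hacc (by linarith) hr η), ← hg,
    ← integral_smul_const, dampedLaplace, ← integral_sub
    (integrableOn_rpow_mul_exp_smul_dampedInverse hacc (by linarith) hr η) (hint.smul_const η),
    ← integral_neg]
  refine setIntegral_congr_fun measurableSet_Ioi fun ρ hρ => ?_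
  rw [mem_Ioi] at hρ
  have h := dampedInverse_add hacc hρ.le η
  simp only [ContinuousLinearMap.map_smul_of_tower]
  conv_rhs => rw [← smul_sub, ← neg_sub, sub_eq_of_eq_add' h.symm]
  rw [smul_neg, smul_smul, show 1 - s = -s + 1 by ring, Real.rpow_add_one hρ.ne']
  ring_nf

theorem tendsto_apply_dampedLaplace (hacc : ∀ f, 0 ≤ (inner ℂ (T f) f).re) (hs0 : 0 < s)
    (hs1 : s < 1) (η : H) :
    Tendsto (fun r => T (dampedLaplace T s η r)) (𝓝[>] 0) (𝓝 (balakrishnan T s η)) := by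
  rw [balakrishnan_apply hacc hs0 hs1]
  have hint := (integrableOn_rpow_smul_comp_dampedInverse hacc hs0 hs1).apply_continuousLinearMap η
  have h : Tendsto (fun r => ∫ ρ in Ioi (0 : ℝ),
      Real.exp (-r * ρ) • (ρ ^ (-s) • T (dampedInverse T ρ η))) (𝓝[>] 0)
      (𝓝 (∫ ρ in Ioi (0 : ℝ), ρ ^ (-s) • T (dampedInverse T ρ η))) := by
    refine tendsto_integral_filter_of_dominated_convergence
      (fun ρ => ‖ρ ^ (-s) • T (dampedInverse T ρ η)‖) ?_ ?_ hint.norm ?_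
    · refine Eventually.of_forall fun r => ?_
      have hc : Continuous fun ρ : ℝ => Real.exp (-r * ρ) := by fun_prop
      exact hc.aestronglyMeasurable.smul hint.aestronglyMeasurable
    · filter_upwards [self_mem_nhdsWithin] with r hr
      filter_upwards [ae_restrict_mem measurableSet_Ioi] with ρ hρ
      rw [mem_Ioi] at hr hρ
      rw [norm_smul, Real.norm_of_nonneg (Real.exp_pos _).le]
      refine mul_le_of_le_one_left (norm_nonneg _) (Real.exp_le_one_iff.2 ?_)
      nlinarith
    · refine Eventually.of_forall fun ρ => ?_
      have : Tendsto (fun r : ℝ => Real.exp (-r * ρ)) (𝓝[>] 0) (𝓝 1) := by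
        have hc : Continuous fun r : ℝ => Real.exp (-r * ρ) := by fun_prop
        simpa using (hc.tendsto 0).mono_left nhdsWithin_le_nhds
      simpa using this.smul_const (ρ ^ (-s) • T (dampedInverse T ρ η))
  refine h.congr' ?_
  filter_upwards [self_mem_nhdsWithin] with r hr
  rw [dampedLaplace, ← ContinuousLinearMap.integral_comp_comm _
    (integrableOn_rpow_mul_exp_smul_dampedInverse hacc (by linarith) hr η)]
  refine integral_congr_ae (Eventually.of_forall fun ρ => ?_)
  simp only [ContinuousLinearMap.map_smul_of_tower, smul_smul, mul_comm]

/-- The initial value of a solution of `T v' = v - r ^ (s-1) η` bounded at infinity is determined by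
`η`: by uniqueness, the solution is `Γ(1-s)⁻¹ • dampedLaplace T s η`. -/
theorem apply_eq_balakrishnan_of_tendsto (hδ : 0 < δ)
    (hT : ∀ f, δ * ‖T f‖ ^ 2 ≤ (inner ℂ (T f) f).re) (hs0 : 0 < s) (hs1 : s < 1)
    {v v' : ℝ → H} {η z : H} (hv : ∀ r, 0 < r → HasDerivAt v (v' r) r)
    (hTv : ∀ r, 0 < r → T (v' r) = v r - r ^ (s - 1) • η) {C : ℝ}
    (hC : ∀ r, 1 ≤ r → ‖v r‖ ≤ C) (hz : Tendsto v (𝓝[>] 0) (𝓝 z)) :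
    Real.Gamma (1 - s) • T z = balakrishnan T s η := by
  have hacc : ∀ f, 0 ≤ (inner ℂ (T f) f).re := fun f => (by positivity : (0 : ℝ) ≤ _).trans (hT f)
  have hΓ : 0 < Real.Gamma (1 - s) := Real.Gamma_pos_of_pos (by linarith)
  have heq : ∀ r, 0 < r → Real.Gamma (1 - s) • v r - dampedLaplace T s η r = 0 := fun r hr => by
    refine eq_zero_of_hasDerivAt_of_bounded hδ hT
      (d := fun r => Real.Gamma (1 - s) • v r - dampedLaplace T s η r)
      (fun r hr => ((hv r hr).const_smul (Real.Gamma (1 - s))).sub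
        (hasDerivAt_dampedLaplace hacc hs1 hr η))
      (fun r hr => ?_) (C := Real.Gamma (1 - s) * C + Real.Gamma (1 - s) * ‖η‖) (fun r hr => ?_) hr
    · rw [map_sub, apply_deriv_dampedLaplace hacc hs1 hr, ContinuousLinearMap.map_smul_of_tower,
        hTv r hr, smul_sub, smul_smul]
      abel
    · refine (norm_sub_le _ _).trans (add_le_add ?_ ?_)
      · rw [norm_smul, Real.norm_of_nonneg hΓ.le]
        exact mul_le_mul_of_nonneg_left (hC r hr) hΓ.le
      · refine (norm_dampedLaplace_le hacc hs1 (one_pos.trans_le hr) η).trans ?_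
        have : r ^ (s - 1) ≤ 1 := Real.rpow_le_one_of_one_le_of_nonpos hr (by linarith)
        refine mul_le_mul_of_nonneg_right ?_ (norm_nonneg _)
        exact mul_le_of_le_one_left hΓ.le this
  refine tendsto_nhds_unique ?_ (tendsto_apply_dampedLaplace hacc hs0 hs1 η)
  have h := ((T.continuous.tendsto z).comp hz).const_smul (Real.Gamma (1 - s))
  refine h.congr' ?_
  filter_upwards [self_mem_nhdsWithin] with r hr
  rw [← sub_eq_zero.1 (heq r hr), ContinuousLinearMap.map_smul_of_tower]
  rfl

end FirstOrder

/-! ### Weak derivatives and traces -/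

section WeakDerivative

variable {X Y : Type*} [NormedAddCommGroup X] [NormedSpace ℂ X]
  [NormedAddCommGroup Y] [NormedSpace ℂ Y]

theorem integrableOn_smul_of_tsupport_subset {𝕜 : Type*} [NormedField 𝕜] {X : Type*}
    [NormedAddCommGroup X] [NormedSpace 𝕜 X]
    {φ : ℝ → 𝕜} (hφ : Continuous φ) (hc : HasCompactSupport φ) (hs : tsupport φ ⊆ Ioi (0 : ℝ))
    {v : ℝ → X} (hv : LocallyIntegrableOn v (Ioi 0)) :
    IntegrableOn (fun t => φ t • v t) (Ioi 0) := by
  have h1 : IntegrableOn (fun t => φ t • v t) (tsupport φ) :=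
    (hv.integrableOn_compact_subset hs hc).continuousOn_smul hφ.continuousOn hc
  have h2 : Integrable (fun t => φ t • v t) := by
    refine (integrableOn_iff_integrable_of_support_subset fun t ht => ?_).1 h1
    refine subset_tsupport φ fun h0 => ht ?_
    simp [h0]
  exact h2.integrableOn

theorem isTestFunction_ofReal {ψ : ℝ → ℝ} (hψ : ContDiff ℝ ∞ ψ) (hc : HasCompactSupport ψ)
    (hs : tsupport ψ ⊆ Ioi (0 : ℝ)) : IsTestFunction fun t => (ψ t : ℂ) := by
  have hsub : tsupport (fun t => (ψ t : ℂ)) ⊆ tsupport ψ :=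
    closure_mono fun t ht h0 => ht (by simp [h0])
  exact ⟨Complex.ofRealCLM.contDiff.comp hψ, hc.mono' (subset_closure.trans hsub), hsub.trans hs⟩

theorem IsWeakDeriv.integral_real_smul {u v : ℝ → X} (h : IsWeakDeriv u v) {ψ : ℝ → ℝ}
    (hψ : ContDiff ℝ ∞ ψ) (hc : HasCompactSupport ψ) (hs : tsupport ψ ⊆ Ioi (0 : ℝ)) :
    -∫ t in Ioi (0 : ℝ), deriv ψ t • u t = ∫ t in Ioi (0 : ℝ), ψ t • v t := by
  have h1 := h.2.2 _ (isTestFunction_ofReal hψ hc hs)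
  have h2 : ∀ t, deriv (fun t => (ψ t : ℂ)) t = ((deriv ψ t : ℝ) : ℂ) := fun t =>
    ((hψ.differentiable (by simp) t).hasDerivAt.ofReal_comp).deriv
  simpa only [h2, Complex.coe_smul] using h1

theorem IsWeakDeriv.ae_unique [CompleteSpace X] {u v w : ℝ → X} (hv : IsWeakDeriv u v)
    (hw : IsWeakDeriv u w) : v =ᵐ[volume.restrict (Ioi (0 : ℝ))] w := by
  have h : ∀ᵐ t, t ∈ Ioi (0 : ℝ) → v t - w t = 0 := by
    refine isOpen_Ioi.ae_eq_zero_of_integral_contDiff_smul_eq_zero (hv.2.1.sub hw.2.1)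
      fun ψ hψ hc hs => ?_
    have h0 : ∫ t in Ioi (0 : ℝ), ψ t • (v t - w t) = 0 := by
      simp only [smul_sub]
      rw [integral_sub (integrableOn_smul_of_tsupport_subset hψ.continuous hc hs hv.2.1)
        (integrableOn_smul_of_tsupport_subset hψ.continuous hc hs hw.2.1),
        ← hv.integral_real_smul hψ hc hs, ← hw.integral_real_smul hψ hc hs, sub_self]
    rw [← h0, setIntegral_eq_integral_of_forall_compl_eq_zero fun t ht => ?_]
    rw [image_eq_zero_of_notMem_tsupport fun h => ht (hs h), zero_smul]
  rw [EventuallyEq, ae_restrict_iff' measurableSet_Ioi]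
  filter_upwards [h] with t ht h0 using sub_eq_zero.1 (ht h0)

theorem locallyIntegrableOn_comp_clm (L : X →L[ℂ] Y) {u : ℝ → X} {S : Set ℝ}
    (hu : LocallyIntegrableOn u S) : LocallyIntegrableOn (fun t => L (u t)) S := fun t ht => by
  obtain ⟨K, hK, hKi⟩ := hu t ht
  exact ⟨K, hK, L.integrable_comp hKi⟩

theorem IsWeakDeriv.comp_clm [CompleteSpace X] [CompleteSpace Y] {u v : ℝ → X}
    (h : IsWeakDeriv u v) (L : X →L[ℂ] Y) :
    IsWeakDeriv (fun t => L (u t)) fun t => L (v t) := by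
  refine ⟨locallyIntegrableOn_comp_clm L h.1, locallyIntegrableOn_comp_clm L h.2.1,
    fun φ hφ => ?_⟩
  have hd : tsupport (deriv φ) ⊆ tsupport φ := closure_minimal (support_deriv_subset)
    (isClosed_tsupport φ)
  have h1 := integrableOn_smul_of_tsupport_subset (hφ.1.continuous_deriv (by simp))
    hφ.2.1.deriv (hd.trans hφ.2.2) h.1
  have h2 := integrableOn_smul_of_tsupport_subset hφ.1.continuous hφ.2.1 hφ.2.2 h.2.1
  have e := congrArg L (h.2.2 φ hφ)
  rw [map_neg, ← L.integral_comp_comm h1, ← L.integral_comp_comm h2] at e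
  simpa using e

theorem IsWeakDeriv.congr_right {u v₁ v₂ : ℝ → X} (h : IsWeakDeriv u v₁)
    (hv : v₁ =ᵐ[volume.restrict (Ioi (0 : ℝ))] v₂) : IsWeakDeriv u v₂ := by
  refine ⟨h.1, fun t ht => ?_, fun φ hφ => ?_⟩
  · obtain ⟨K, hK, hKi⟩ := h.2.1 t ht
    refine ⟨K ∩ Ioi 0, inter_mem hK self_mem_nhdsWithin, ?_⟩
    exact (hKi.mono_set inter_subset_left).congr (ae_restrict_of_ae_restrict_of_subset
      inter_subset_right hv)
  · rw [h.2.2 φ hφ]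
    refine integral_congr_ae ?_
    filter_upwards [hv] with t ht
    rw [ht]

theorem IsTraceAtZero.comp_clm {u : ℝ → X} {x : X} (h : IsTraceAtZero u x) (L : X →L[ℂ] Y) :
    IsTraceAtZero (fun t => L (u t)) (L x) := by
  obtain ⟨c, hc, hcu, hx⟩ := h
  exact ⟨fun t => L (c t), L.continuous.comp_continuousOn hc, hcu.fun_comp L,
    (L.continuous.tendsto x).comp hx⟩

theorem IsTraceAtZero.congr {X : Type*} [NormedAddCommGroup X] {u₁ u₂ : ℝ → X} {x : X}
    (h : IsTraceAtZero u₁ x)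
    (hu : u₁ =ᵐ[volume.restrict (Ioi (0 : ℝ))] u₂) : IsTraceAtZero u₂ x := by
  obtain ⟨c, hc, hcu, hx⟩ := h
  exact ⟨c, hc, hcu.trans hu, hx⟩

theorem deriv_smoothTransition_eq_zero {x : ℝ} (hx : x ∉ Icc (0 : ℝ) 1) :
    deriv Real.smoothTransition x = 0 := by
  rw [mem_Icc, not_and_or, not_le, not_le] at hx
  rcases hx with hx | hx
  · have : Real.smoothTransition =ᶠ[𝓝 x] fun _ => 0 := by
      filter_upwards [Iio_mem_nhds hx] with y hy
      exact Real.smoothTransition.zero_of_nonpos (le_of_lt hy)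
    rw [this.deriv_eq, deriv_const]
  · have : Real.smoothTransition =ᶠ[𝓝 x] fun _ => 1 := by
      filter_upwards [Ioi_mem_nhds hx] with y hy
      exact Real.smoothTransition.one_of_one_le (le_of_lt hy)
    rw [this.deriv_eq, deriv_const]

theorem hasCompactSupport_deriv_smoothTransition :
    HasCompactSupport (deriv Real.smoothTransition) :=
  HasCompactSupport.intro isCompact_Icc fun _ hx => deriv_smoothTransition_eq_zero hx

theorem continuous_deriv_smoothTransition : Continuous (deriv Real.smoothTransition) :=
  (Real.smoothTransition.contDiff (n := 1)).continuous_deriv le_rfl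

theorem hasDerivAt_smoothTransition (x : ℝ) :
    HasDerivAt Real.smoothTransition (deriv Real.smoothTransition x) x :=
  ((Real.smoothTransition.contDiff (n := 1)).differentiable one_ne_zero x).hasDerivAt

theorem integral_deriv_smoothTransition :
    ∫ τ in Ioi (0 : ℝ), deriv Real.smoothTransition (τ - 1) = 1 := by
  have hint : Integrable fun τ : ℝ => deriv Real.smoothTransition (τ - 1) :=
    (continuous_deriv_smoothTransition.integrable_of_hasCompactSupport
      hasCompactSupport_deriv_smoothTransition).comp_sub_right 1
  have h := integral_Ioi_of_hasDerivAt_of_tendsto' (a := (0 : ℝ)) (m := (1 : ℝ))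
    (f := fun τ => Real.smoothTransition (τ - 1))
    (f' := fun τ => deriv Real.smoothTransition (τ - 1))
    (fun τ _ => (hasDerivAt_smoothTransition (τ - 1)).comp_sub_const τ 1) hint.integrableOn
    (tendsto_const_nhds.congr' (by
      filter_upwards [eventually_ge_atTop 2] with τ hτ
      rw [Real.smoothTransition.one_of_one_le (by linarith)]))
  rw [h, Real.smoothTransition.zero_of_nonpos (by norm_num), sub_zero]

/-- The cutoff which vanishes on `t ≤ ε` and on `t ≥ 2 / ε` and equals one on `[2 ε, 1 / ε]`. -/
noncomputable def cutoff (ε t : ℝ) : ℝ :=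
  Real.smoothTransition (ε⁻¹ * t - 1) * Real.smoothTransition (2 - ε * t)

theorem cutoff_nonneg (ε t : ℝ) : 0 ≤ cutoff ε t :=
  mul_nonneg (Real.smoothTransition.nonneg _) (Real.smoothTransition.nonneg _)

theorem cutoff_le_one (ε t : ℝ) : cutoff ε t ≤ 1 :=
  mul_le_one₀ (Real.smoothTransition.le_one _) (Real.smoothTransition.nonneg _)
    (Real.smoothTransition.le_one _)

theorem contDiff_cutoff (ε : ℝ) : ContDiff ℝ ∞ (cutoff ε) :=
  ((Real.smoothTransition.contDiff (n := ⊤)).comp (by fun_prop)).mul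
    ((Real.smoothTransition.contDiff (n := ⊤)).comp (by fun_prop))

theorem cutoff_eq_zero {ε t : ℝ} (hε : 0 < ε) (ht : t ∉ Icc ε (2 / ε)) : cutoff ε t = 0 := by
  rw [mem_Icc, not_and_or, not_le, not_le] at ht
  rcases ht with ht | ht
  · rw [cutoff, Real.smoothTransition.zero_of_nonpos, zero_mul]
    rw [inv_mul_eq_div, sub_nonpos, div_le_one hε]; exact ht.le
  · rw [cutoff, mul_comm, Real.smoothTransition.zero_of_nonpos, zero_mul]
    rw [div_lt_iff₀ hε] at ht; linarith

theorem tendsto_cutoff {t : ℝ} (ht : 0 < t) : Tendsto (fun ε => cutoff ε t) (𝓝[>] 0) (𝓝 1) := by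
  refine tendsto_const_nhds.congr' ?_
  have h1 : ∀ᶠ ε in 𝓝[>] (0 : ℝ), ε < t / 2 :=
    nhdsWithin_le_nhds (Iio_mem_nhds (by positivity))
  have h2 : ∀ᶠ ε in 𝓝[>] (0 : ℝ), ε < 1 / t :=
    nhdsWithin_le_nhds (Iio_mem_nhds (by positivity))
  filter_upwards [h1, h2, self_mem_nhdsWithin] with ε h1 h2 h3
  rw [mem_Ioi] at h3
  rw [lt_div_iff₀ ht] at h2
  rw [cutoff, Real.smoothTransition.one_of_one_le, Real.smoothTransition.one_of_one_le, one_mul]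
  · linarith
  · rw [inv_mul_eq_div, le_sub_iff_add_le, le_div_iff₀ h3]; linarith

theorem hasDerivAt_cutoff (ε t : ℝ) : HasDerivAt (cutoff ε)
    (ε⁻¹ * deriv Real.smoothTransition (ε⁻¹ * t - 1) * Real.smoothTransition (2 - ε * t) -
      ε * (Real.smoothTransition (ε⁻¹ * t - 1) * deriv Real.smoothTransition (2 - ε * t))) t := by
  have h1 : HasDerivAt (fun t => ε⁻¹ * t - 1) ε⁻¹ t := by
    simpa using ((hasDerivAt_id t).const_mul ε⁻¹).sub_const 1
  have h2 : HasDerivAt (fun t => 2 - ε * t) (-ε) t := by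
    simpa using ((hasDerivAt_id t).const_mul ε).const_sub 2
  refine (((hasDerivAt_smoothTransition _).comp t h1).mul
    ((hasDerivAt_smoothTransition _).comp t h2)).congr_deriv ?_
  simp only [Function.comp_apply]
  ring

/-- The part of the derivative of the cutoff near zero is an approximate identity at `0+`. -/
theorem tendsto_integral_deriv_smoothTransition_smul [CompleteSpace X] {g : ℝ → X} {a : X}
    (hg : ContinuousOn g (Ioi 0)) (ha : Tendsto g (𝓝[>] 0) (𝓝 a)) :
    Tendsto (fun ε : ℝ => ∫ t in Ioi (0 : ℝ),
      (ε⁻¹ * deriv Real.smoothTransition (ε⁻¹ * t - 1) * Real.smoothTransition (2 - ε * t)) • g t)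
      (𝓝[>] 0) (𝓝 a) := by
  obtain ⟨M, hM⟩ := hasCompactSupport_deriv_smoothTransition.exists_bound_of_continuous
    continuous_deriv_smoothTransition
  have hM0 : 0 ≤ M := (norm_nonneg _).trans (hM 0)
  have hbd : ∀ᶠ t in 𝓝[>] (0 : ℝ), ‖g t‖ < ‖a‖ + 1 :=
    ha.norm.eventually_lt_const (lt_add_one _)
  obtain ⟨δ, hδ, hδg⟩ := mem_nhdsGT_iff_exists_Ioo_subset.1 hbd
  rw [mem_Ioi] at hδ
  -- after the substitution `t = ε τ` the weight is supported in the fixed interval `[1, 2]`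
  have hsubst : ∀ ε : ℝ, 0 < ε → ∫ t in Ioi (0 : ℝ),
      (ε⁻¹ * deriv Real.smoothTransition (ε⁻¹ * t - 1) * Real.smoothTransition (2 - ε * t)) • g t =
      ∫ τ in Ioi (0 : ℝ), (deriv Real.smoothTransition (τ - 1) *
        Real.smoothTransition (2 - ε * (ε * τ))) • g (ε * τ) := fun ε hε => by
    have h := integral_comp_mul_left_Ioi (fun t => (deriv Real.smoothTransition (ε⁻¹ * t - 1) *
      Real.smoothTransition (2 - ε * t)) • g t) 0 hε
    rw [mul_zero] at h
    simp only [inv_mul_cancel_left₀ hε.ne'] at h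
    rw [h, ← integral_smul]
    simp only [smul_smul, mul_assoc]
  have hlim : Tendsto (fun ε : ℝ => ∫ τ in Ioi (0 : ℝ), (deriv Real.smoothTransition (τ - 1) *
        Real.smoothTransition (2 - ε * (ε * τ))) • g (ε * τ)) (𝓝[>] 0)
      (𝓝 (∫ τ in Ioi (0 : ℝ), deriv Real.smoothTransition (τ - 1) • a)) := by
    refine tendsto_integral_filter_of_dominated_convergence
      ((Icc (1 : ℝ) 2).indicator fun _ => M * (‖a‖ + 1)) ?_ ?_ ?_ ?_
    · filter_upwards [self_mem_nhdsWithin] with ε hε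
      rw [mem_Ioi] at hε
      refine ContinuousOn.aestronglyMeasurable ?_ measurableSet_Ioi
      have h1 : Continuous fun τ : ℝ => deriv Real.smoothTransition (τ - 1) *
          Real.smoothTransition (2 - ε * (ε * τ)) :=
        (continuous_deriv_smoothTransition.comp (by fun_prop)).mul
          (Real.smoothTransition.continuous.comp (by fun_prop))
      have h2 : ContinuousOn (fun τ => g (ε * τ)) (Ioi 0) :=
        hg.comp (Continuous.continuousOn (by fun_prop)) fun τ hτ => mul_pos hε hτ
      exact h1.continuousOn.smul h2
    · have hsmall : ∀ᶠ ε in 𝓝[>] (0 : ℝ), ε < δ / 2 :=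
        nhdsWithin_le_nhds (Iio_mem_nhds (by positivity))
      filter_upwards [self_mem_nhdsWithin, hsmall] with ε hε hεδ
      rw [mem_Ioi] at hε
      refine Eventually.of_forall fun τ => ?_
      by_cases hτ : τ ∈ Icc (1 : ℝ) 2
      · rw [indicator_of_mem hτ, norm_smul, norm_mul]
        have h1 : ‖Real.smoothTransition (2 - ε * (ε * τ))‖ ≤ 1 := by
          rw [Real.norm_of_nonneg (Real.smoothTransition.nonneg _)]
          exact Real.smoothTransition.le_one _
        have h2 : ‖g (ε * τ)‖ ≤ ‖a‖ + 1 := le_of_lt (hδg ⟨by nlinarith [hτ.1], by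
          nlinarith [hτ.1, hτ.2]⟩)
        exact mul_le_mul ((mul_le_mul (hM _) h1 (norm_nonneg _) hM0).trans_eq (mul_one _)) h2
          (norm_nonneg _) hM0
      · rw [indicator_of_notMem hτ, deriv_smoothTransition_eq_zero]
        · simp
        · exact fun h => hτ ⟨by linarith [h.1], by linarith [h.2]⟩
    · refine Integrable.integrableOn ?_
      rw [integrable_indicator_iff measurableSet_Icc]
      exact integrableOn_const (by simp)
    · filter_upwards [ae_restrict_mem measurableSet_Ioi] with τ hτ
      rw [mem_Ioi] at hτ
      have h1 : Tendsto (fun ε : ℝ => ε * τ) (𝓝[>] 0) (𝓝[>] 0) := by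
        refine tendsto_nhdsWithin_iff.2 ⟨?_, ?_⟩
        · have : Continuous fun ε : ℝ => ε * τ := by fun_prop
          simpa using (this.tendsto 0).mono_left nhdsWithin_le_nhds
        · filter_upwards [self_mem_nhdsWithin] with ε hε using mul_pos hε hτ
      have h2 : Tendsto (fun ε : ℝ => deriv Real.smoothTransition (τ - 1) *
          Real.smoothTransition (2 - ε * (ε * τ))) (𝓝[>] 0)
          (𝓝 (deriv Real.smoothTransition (τ - 1))) := by
        have hc : Continuous fun ε : ℝ => deriv Real.smoothTransition (τ - 1) *
            Real.smoothTransition (2 - ε * (ε * τ)) :=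
          continuous_const.mul (Real.smoothTransition.continuous.comp (by fun_prop))
        have := (hc.tendsto 0).mono_left (nhdsWithin_le_nhds (s := Ioi 0))
        simpa [Real.smoothTransition.one_of_one_le (by norm_num : (1 : ℝ) ≤ 2)] using this
      exact h2.smul (ha.comp h1)
  rw [integral_smul_const, integral_deriv_smoothTransition, one_smul] at hlim
  refine hlim.congr' ?_
  filter_upwards [self_mem_nhdsWithin] with ε hε using (hsubst ε hε).symm

/-- Integration by parts on `(0, ∞)` for a weakly differentiable function with a trace at zero, the
weight `p` being smooth on `(0, ∞)` with a limit at zero. Testing with `cutoff ε * p` and letting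
`ε ↓ 0`, the derivative of the cutoff near zero produces the boundary term. -/
theorem IsWeakDeriv.integral_smul_eq_sub [CompleteSpace X] {f g : ℝ → X} {f₀ : X}
    (h : IsWeakDeriv f g) (htr : IsTraceAtZero f f₀) {p : ℝ → ℝ} {p₀ : ℝ}
    (hp : ContDiffOn ℝ ∞ p (Ioi 0)) (hp₀ : Tendsto p (𝓝[>] 0) (𝓝 p₀))
    (hpg : IntegrableOn (fun t => p t • g t) (Ioi 0))
    (hpf : IntegrableOn (fun t => p t • f t) (Ioi 0))
    (hp'f : IntegrableOn (fun t => deriv p t • f t) (Ioi 0)) :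
    ∫ t in Ioi (0 : ℝ), p t • g t = -(∫ t in Ioi (0 : ℝ), deriv p t • f t) - p₀ • f₀ := by
  obtain ⟨c, hc, hcf, hc₀⟩ := htr
  obtain ⟨M, hM⟩ := hasCompactSupport_deriv_smoothTransition.exists_bound_of_continuous
    continuous_deriv_smoothTransition
  have hpat : ∀ t, 0 < t → ContDiffAt ℝ ∞ p t := fun t ht => hp.contDiffAt (Ioi_mem_nhds ht)
  have hcut : ∀ {w : ℝ → X}, IntegrableOn w (Ioi 0) →
      Tendsto (fun ε => ∫ t in Ioi (0 : ℝ), cutoff ε t • w t) (𝓝[>] 0)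
        (𝓝 (∫ t in Ioi (0 : ℝ), w t)) := fun {w} hw => by
    refine tendsto_integral_filter_of_dominated_convergence (fun t => ‖w t‖) ?_ ?_ hw.norm ?_
    · exact Eventually.of_forall fun ε =>
        (contDiff_cutoff ε).continuous.aestronglyMeasurable.smul hw.aestronglyMeasurable
    · refine Eventually.of_forall fun ε => Eventually.of_forall fun t => ?_
      rw [norm_smul, Real.norm_of_nonneg (cutoff_nonneg _ _)]
      exact mul_le_of_le_one_left (norm_nonneg _) (cutoff_le_one _ _)
    · filter_upwards [ae_restrict_mem measurableSet_Ioi] with t ht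
      simpa using (tendsto_cutoff ht).smul_const (w t)
  -- the three contributions to the derivative of `cutoff ε * p`
  set A : ℝ → ℝ → ℝ := fun ε t =>
    ε⁻¹ * deriv Real.smoothTransition (ε⁻¹ * t - 1) * Real.smoothTransition (2 - ε * t)
  set B : ℝ → ℝ → ℝ := fun ε t =>
    Real.smoothTransition (ε⁻¹ * t - 1) * deriv Real.smoothTransition (2 - ε * t)
  have hAcont : ∀ ε, Continuous (A ε) := fun ε =>
    (continuous_const.mul (continuous_deriv_smoothTransition.comp (by fun_prop))).mul
      (Real.smoothTransition.continuous.comp (by fun_prop))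
  have hBcont : ∀ ε, Continuous (B ε) := fun ε =>
    (Real.smoothTransition.continuous.comp (by fun_prop)).mul
      (continuous_deriv_smoothTransition.comp (by fun_prop))
  have hBle : ∀ ε t, ‖B ε t‖ ≤ M := fun ε t => by
    rw [norm_mul, Real.norm_of_nonneg (Real.smoothTransition.nonneg _)]
    exact (mul_le_of_le_one_left (norm_nonneg _) (Real.smoothTransition.le_one _)).trans (hM _)
  have hAle : ∀ ε t, ‖A ε t‖ ≤ ‖ε⁻¹‖ * M := fun ε t => by
    rw [norm_mul, norm_mul, Real.norm_of_nonneg (Real.smoothTransition.nonneg (2 - ε * t))]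
    exact (mul_le_of_le_one_right (by positivity) (Real.smoothTransition.le_one _)).trans
      (mul_le_mul_of_nonneg_left (hM _) (norm_nonneg _))
  have hAint : ∀ ε, IntegrableOn (fun t => A ε t • (p t • f t)) (Ioi 0) := fun ε =>
    Integrable.bdd_smul (𝕜 := ℝ) hpf _ (hAcont ε).aestronglyMeasurable (Eventually.of_forall (hAle ε))
  have hBint : ∀ ε, IntegrableOn (fun t => B ε t • (p t • f t)) (Ioi 0) := fun ε =>
    Integrable.bdd_smul (𝕜 := ℝ) hpf _ (hBcont ε).aestronglyMeasurable (Eventually.of_forall (hBle ε))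
  have hCint : ∀ ε, IntegrableOn (fun t => cutoff ε t • (deriv p t • f t)) (Ioi 0) := fun ε =>
    Integrable.bdd_smul (𝕜 := ℝ) hp'f 1 (contDiff_cutoff ε).continuous.aestronglyMeasurable
      (Eventually.of_forall fun t => by
        rw [Real.norm_of_nonneg (cutoff_nonneg _ _)]; exact cutoff_le_one _ _)
  have hkey : ∀ ε, 0 < ε → ∫ t in Ioi (0 : ℝ), cutoff ε t • (p t • g t) =
      -((∫ t in Ioi (0 : ℝ), A ε t • (p t • f t)) - ε • (∫ t in Ioi (0 : ℝ), B ε t • (p t • f t)) +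
        ∫ t in Ioi (0 : ℝ), cutoff ε t • (deriv p t • f t)) := fun ε hε => by
    have hsupp : Function.support (fun t => cutoff ε t * p t) ⊆ Icc ε (2 / ε) := fun t ht => by
      by_contra h0
      exact ht (by simp [cutoff_eq_zero hε h0])
    have htsupp : tsupport (fun t => cutoff ε t * p t) ⊆ Icc ε (2 / ε) :=
      closure_minimal hsupp isClosed_Icc
    have hsmooth : ContDiff ℝ ∞ fun t => cutoff ε t * p t := by
      rw [contDiff_iff_contDiffAt]
      intro t
      rcases lt_or_ge 0 t with ht | ht
      · exact (contDiff_cutoff ε).contDiffAt.mul (hpat t ht)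
      · refine contDiffAt_const (c := (0 : ℝ)) |>.congr_of_eventuallyEq ?_
        filter_upwards [Iio_mem_nhds (ht.trans_lt hε)] with y hy
        rw [cutoff_eq_zero hε fun h => absurd h.1 (not_le.2 hy), zero_mul]
    have h1 := h.integral_real_smul hsmooth (HasCompactSupport.of_support_subset_isCompact
      isCompact_Icc hsupp) (htsupp.trans fun t ht => hε.trans_le ht.1)
    simp only [smul_smul] at hAint hBint hCint ⊢
    have hεB : IntegrableOn (fun t => ε • (B ε t * p t) • f t) (Ioi 0) := (hBint ε).smul ε
    have hAB : IntegrableOn (fun t => (A ε t * p t) • f t - ε • (B ε t * p t) • f t) (Ioi 0) :=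
      (hAint ε).sub hεB
    rw [← h1, ← integral_smul, ← integral_sub (hAint ε) hεB, ← integral_add hAB (hCint ε)]
    congr 1
    refine setIntegral_congr_fun measurableSet_Ioi fun t ht => ?_
    have h2 := ((hasDerivAt_cutoff ε t).mul
      ((hpat t ht).differentiableAt (by simp)).hasDerivAt).deriv
    change deriv (fun t => cutoff ε t * p t) t • f t = _
    change deriv (fun t => cutoff ε t * p t) t = _ at h2
    simp only [h2, smul_smul, ← sub_smul, ← add_smul, A, B]
    congr 1
    ring
  have hAlim : Tendsto (fun ε => ∫ t in Ioi (0 : ℝ), A ε t • (p t • f t)) (𝓝[>] 0)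
      (𝓝 (p₀ • f₀)) := by
    have := tendsto_integral_deriv_smoothTransition_smul (g := fun t => p t • c t)
      (hp.continuousOn.smul hc) (hp₀.smul hc₀)
    refine this.congr fun ε => integral_congr_ae ?_
    filter_upwards [hcf] with t ht
    simp only [ht, A]
  have hBlim : Tendsto (fun ε : ℝ => ε • ∫ t in Ioi (0 : ℝ), B ε t • (p t • f t)) (𝓝[>] 0)
      (𝓝 0) := by
    have hb : ∀ ε, ‖∫ t in Ioi (0 : ℝ), B ε t • (p t • f t)‖ ≤
        ∫ t in Ioi (0 : ℝ), M * ‖p t • f t‖ := fun ε =>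
      norm_integral_le_of_norm_le (hpf.norm.const_mul M) (Eventually.of_forall fun t => by
        rw [norm_smul]; exact mul_le_mul_of_nonneg_right (hBle ε t) (norm_nonneg _))
    have hid : Tendsto (fun ε : ℝ => ε) (𝓝[>] 0) (𝓝 0) := tendsto_id.mono_left nhdsWithin_le_nhds
    refine hid.zero_smul_isBoundedUnder_le ?_
    exact isBoundedUnder_of ⟨_, hb⟩
  have hR := ((hAlim.sub hBlim).add (hcut hp'f)).neg
  have hL := (hcut hpg).congr' (by
    filter_upwards [self_mem_nhdsWithin] with ε hε using hkey ε hε)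
  rw [tendsto_nhds_unique hL hR]
  abel

end WeakDerivative

/-! ### Weighted Gaussian integrals -/

section Gaussian

variable {H : Type*} [NormedAddCommGroup H] [NormedSpace ℂ H] {s : ℝ}

theorem continuousOn_rpow_mul_exp_neg_mul_sq (a b : ℝ) :
    ContinuousOn (fun t : ℝ => t ^ a * Real.exp (-b * t ^ 2)) (Ioi 0) := fun t ht =>
  ((Real.continuousAt_rpow_const _ _ (Or.inl (ne_of_gt ht))).mul
    (by fun_prop)).continuousWithinAt

theorem memLp_two_rpow_mul_exp_neg_mul_sq {a b : ℝ} (ha : -(1 / 2) < a) (hb : 0 < b) :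
    MemLp (fun t : ℝ => t ^ a * Real.exp (-b * t ^ 2)) 2 (volume.restrict (Ioi 0)) := by
  rw [memLp_two_iff_integrable_sq
    ((continuousOn_rpow_mul_exp_neg_mul_sq a b).aestronglyMeasurable measurableSet_Ioi)]
  have h := integrableOn_rpow_mul_exp_neg_mul_sq (b := 2 * b) (by positivity) (s := 2 * a)
    (by linarith)
  refine IntegrableOn.congr_fun h (fun t ht => ?_) measurableSet_Ioi
  rw [mem_Ioi] at ht
  rw [mul_pow, ← Real.exp_nat_mul, ← Real.rpow_natCast (t ^ a), ← Real.rpow_mul ht.le]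
  push_cast
  ring_nf

/-- By the Cauchy–Schwarz inequality; the condition on `a` makes the square of the weight
`t ^ (a - 1/2 + s) e^(-b t²)` integrable at zero. -/
theorem integrableOn_rpow_mul_exp_smul {U : ℝ → H}
    (hU : MemLp (fun t : ℝ => t ^ (1 / 2 - s) • U t) 2 (volume.restrict (Ioi 0))) {a b : ℝ}
    (ha : -s < a) (hb : 0 < b) :
    IntegrableOn (fun t : ℝ => (t ^ a * Real.exp (-b * t ^ 2)) • U t) (Ioi 0) := by
  have h1 : MemLp ((fun t : ℝ => t ^ (a - 1 / 2 + s) * Real.exp (-b * t ^ 2)) •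
      fun t : ℝ => t ^ (1 / 2 - s) • U t) 1 (volume.restrict (Ioi 0)) :=
    MemLp.smul (𝕜 := ℝ) hU (memLp_two_rpow_mul_exp_neg_mul_sq (by linarith) hb)
  refine IntegrableOn.congr_fun (memLp_one_iff_integrable.1 h1) (fun t ht => ?_) measurableSet_Ioi
  rw [mem_Ioi] at ht
  simp only [Pi.smul_apply', smul_smul]
  rw [mul_right_comm, ← Real.rpow_add ht]
  ring_nf

theorem integral_rpow_mul_exp_neg_mul_sq (hs1 : s < 1) {b : ℝ} (hb : 0 < b) :
    ∫ t in Ioi (0 : ℝ), t ^ (1 - 2 * s) * Real.exp (-b * t ^ 2) =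
      b ^ (s - 1) * (1 / 2 * Real.Gamma (1 - s)) := by
  have h := integral_rpow_mul_exp_neg_mul_rpow (p := 2) (q := 1 - 2 * s) two_pos (by linarith) hb
  simp only [Real.rpow_two] at h
  rw [h, show -(1 - 2 * s + 1) / 2 = s - 1 by ring, show (1 - 2 * s + 1) / 2 = 1 - s by ring,
    mul_assoc]

/-- The pairing of `U` with the Gaussian `e^(-b t²)` for the measure `t ^ (1-2s) dt`. -/
noncomputable def gaussTransform (s : ℝ) (U : ℝ → H) (b : ℝ) : H :=
  ∫ t in Ioi (0 : ℝ), (t ^ (1 - 2 * s) * Real.exp (-b * t ^ 2)) • U t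

theorem hasDerivAt_gaussTransform {U : ℝ → H}
    (hU : MemLp (fun t : ℝ => t ^ (1 / 2 - s) • U t) 2 (volume.restrict (Ioi 0))) (hs1 : s < 1)
    {b : ℝ} (hb : 0 < b) :
    HasDerivAt (gaussTransform s U)
      (-∫ t in Ioi (0 : ℝ), (t ^ (3 - 2 * s) * Real.exp (-b * t ^ 2)) • U t) b := by
  have hnhds : Ioi (b / 2) ∈ 𝓝 b := Ioi_mem_nhds (by linarith)
  have h := hasDerivAt_integral_of_dominated_loc_of_deriv_le
    (μ := volume.restrict (Ioi (0 : ℝ))) (s := Ioi (b / 2)) (x₀ := b)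
    (F := fun b t => (t ^ (1 - 2 * s) * Real.exp (-b * t ^ 2)) • U t)
    (F' := fun b t => -((t ^ (3 - 2 * s) * Real.exp (-b * t ^ 2)) • U t))
    (bound := fun t => ‖(t ^ (3 - 2 * s) * Real.exp (-(b / 2) * t ^ 2)) • U t‖)
    hnhds
    (by
      filter_upwards [hnhds] with x hx
      exact (integrableOn_rpow_mul_exp_smul hU (by linarith)
        ((half_pos hb).trans hx)).aestronglyMeasurable)
    (integrableOn_rpow_mul_exp_smul hU (by linarith) hb)
    (integrableOn_rpow_mul_exp_smul hU (by linarith) hb).aestronglyMeasurable.neg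
    (by
      filter_upwards [ae_restrict_mem measurableSet_Ioi] with t ht x hx
      rw [mem_Ioi] at ht hx
      rw [norm_neg, norm_smul, norm_smul, Real.norm_of_nonneg (by positivity),
        Real.norm_of_nonneg (by positivity)]
      gcongr)
    (integrableOn_rpow_mul_exp_smul hU (by linarith) (half_pos hb)).norm
    (by
      filter_upwards [ae_restrict_mem measurableSet_Ioi] with t ht x _
      rw [mem_Ioi] at ht
      have h1 : HasDerivAt (fun b : ℝ => t ^ (1 - 2 * s) * Real.exp (-b * t ^ 2))
          (t ^ (1 - 2 * s) * (Real.exp (-x * t ^ 2) * (-1 * t ^ 2))) x :=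
        (((hasDerivAt_id x).neg.mul_const (t ^ 2)).exp).const_mul _
      refine (h1.smul_const (U t)).congr_deriv ?_
      rw [← neg_smul]
      congr 1
      rw [show 3 - 2 * s = 1 - 2 * s + (2 : ℕ) by push_cast; ring, Real.rpow_add_natCast ht.ne']
      ring)
  have h2 := h.2
  rw [integral_neg] at h2
  exact h2

theorem norm_gaussTransform_le {U : ℝ → H}
    (hU : MemLp (fun t : ℝ => t ^ (1 / 2 - s) • U t) 2 (volume.restrict (Ioi 0))) (hs1 : s < 1)
    {b : ℝ} (hb : 0 < b) :
    ‖gaussTransform s U b‖ ≤ ((2 * b) ^ (s - 1) * (1 / 2 * Real.Gamma (1 - s)) +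
      ∫ t in Ioi (0 : ℝ), ‖t ^ (1 / 2 - s) • U t‖ ^ 2) / 2 := by
  have h2b : 0 < 2 * b := by positivity
  have h1 := integrableOn_rpow_mul_exp_neg_mul_sq h2b (s := 1 - 2 * s) (by linarith)
  have h2 := (memLp_two_iff_integrable_sq_norm hU.aestronglyMeasurable).1 hU
  rw [← integral_rpow_mul_exp_neg_mul_sq hs1 h2b, ← integral_add h1 h2, ← integral_div]
  refine norm_integral_le_of_norm_le ((h1.add h2).div_const 2) ?_
  filter_upwards [ae_restrict_mem measurableSet_Ioi] with t ht
  rw [mem_Ioi] at ht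
  have e1 : t ^ (1 - 2 * s) = t ^ (1 / 2 - s) * t ^ (1 / 2 - s) := by
    rw [← Real.rpow_add ht]; ring_nf
  have e2 : Real.exp (-(2 * b) * t ^ 2) = Real.exp (-b * t ^ 2) * Real.exp (-b * t ^ 2) := by
    rw [← Real.exp_add]; ring_nf
  have hp := Real.rpow_pos_of_pos ht (1 / 2 - s)
  rw [norm_smul, norm_smul, Real.norm_of_nonneg (by positivity), Real.norm_of_nonneg hp.le, e1, e2,
    le_div_iff₀ two_pos]
  nlinarith [sq_nonneg (t ^ (1 / 2 - s) * Real.exp (-b * t ^ 2) - t ^ (1 / 2 - s) * ‖U t‖)]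

theorem contDiffOn_rpow_mul_exp_neg_mul_sq (a b : ℝ) :
    ContDiffOn ℝ ∞ (fun t : ℝ => t ^ a * Real.exp (-b * t ^ 2)) (Ioi 0) := fun t ht => by
  have h : ContDiff ℝ ∞ fun t : ℝ => Real.exp (-b * t ^ 2) := by fun_prop
  exact ((Real.contDiffAt_rpow_const_of_ne (ne_of_gt ht)).mul h.contDiffAt).contDiffWithinAt

theorem deriv_rpow_mul_exp_neg_mul_sq (a b : ℝ) {t : ℝ} (ht : 0 < t) :
    deriv (fun t : ℝ => t ^ a * Real.exp (-b * t ^ 2)) t =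
      a * (t ^ (a - 1) * Real.exp (-b * t ^ 2)) -
        2 * b * (t ^ (a + 1) * Real.exp (-b * t ^ 2)) := by
  have h1 : HasDerivAt (fun t : ℝ => t ^ a) (a * t ^ (a - 1)) t :=
    Real.hasDerivAt_rpow_const (Or.inl ht.ne')
  have h2 : HasDerivAt (fun t : ℝ => Real.exp (-b * t ^ 2))
      (Real.exp (-b * t ^ 2) * (-b * (2 * t))) t := by
    simpa using ((hasDerivAt_pow 2 t).const_mul (-b)).exp
  refine (h1.mul h2).deriv.trans ?_
  rw [Real.rpow_add_one ht.ne']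
  ring

/-- The heat extension `r ^ (s-1) ∫₀^∞ t ^ (1-2s) e^(-t²/(4r)) U(t) dt`. Its kernel solves the heat
equation for the operator `t ^ (2s-1) ∂ₜ t ^ (1-2s) ∂ₜ`, with concentration at `t = 0` as
`r ↓ 0`. -/
noncomputable def heatTransform (s : ℝ) (U : ℝ → H) (r : ℝ) : H :=
  r ^ (s - 1) • gaussTransform s U (4 * r)⁻¹

theorem exists_norm_heatTransform_le {U : ℝ → H}
    (hU : MemLp (fun t : ℝ => t ^ (1 / 2 - s) • U t) 2 (volume.restrict (Ioi 0))) (hs1 : s < 1) :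
    ∃ C, ∀ r, 1 ≤ r → ‖heatTransform s U r‖ ≤ C := by
  set K := ∫ t in Ioi (0 : ℝ), ‖t ^ (1 / 2 - s) • U t‖ ^ 2 with hK
  have hK0 : 0 ≤ K := integral_nonneg fun t => by positivity
  have hΓ : 0 < Real.Gamma (1 - s) := Real.Gamma_pos_of_pos (by linarith)
  refine ⟨((2⁻¹ : ℝ) ^ (s - 1) * (1 / 2 * Real.Gamma (1 - s)) + K) / 2, fun r hr => ?_⟩
  have hr0 : 0 < r := by linarith
  have h := norm_gaussTransform_le hU hs1 (b := (4 * r)⁻¹) (by positivity)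
  have h1 : r ^ (s - 1) ≤ 1 := Real.rpow_le_one_of_one_le_of_nonpos hr (by linarith)
  have hrp : 0 < r ^ (s - 1) := Real.rpow_pos_of_pos hr0 _
  have e : r ^ (s - 1) * (2 * (4 * r)⁻¹) ^ (s - 1) = (2⁻¹ : ℝ) ^ (s - 1) := by
    rw [← Real.mul_rpow hr0.le (by positivity)]
    congr 1
    field_simp
    norm_num
  rw [heatTransform, norm_smul, Real.norm_of_nonneg hrp.le]
  refine (mul_le_mul_of_nonneg_left h hrp.le).trans ?_
  rw [← hK, ← mul_div_assoc, mul_add, ← mul_assoc, e]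
  have := mul_le_of_le_one_left hK0 h1
  gcongr

theorem hasDerivAt_heatTransform {U : ℝ → H}
    (hU : MemLp (fun t : ℝ => t ^ (1 / 2 - s) • U t) 2 (volume.restrict (Ioi 0))) (hs1 : s < 1)
    {r : ℝ} (hr : 0 < r) :
    HasDerivAt (heatTransform s U)
      ((r ^ (s - 1) * r⁻¹) • ((s - 1) • gaussTransform s U (4 * r)⁻¹ + (4 * r)⁻¹ •
        ∫ t in Ioi (0 : ℝ), (t ^ (3 - 2 * s) * Real.exp (-(4 * r)⁻¹ * t ^ 2)) • U t)) r := by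
  have h4 : 0 < (4 * r)⁻¹ := by positivity
  have h1 : HasDerivAt (fun r : ℝ => (4 * r)⁻¹) (-(4 * 1) / (4 * r) ^ 2) r :=
    ((hasDerivAt_id r).const_mul 4).inv (by positivity)
  have h2 : HasDerivAt (fun r : ℝ => r ^ (s - 1)) ((s - 1) * (r ^ (s - 1) * r⁻¹)) r := by
    have := Real.hasDerivAt_rpow_const (p := s - 1) (Or.inl hr.ne')
    rwa [Real.rpow_sub_one hr.ne', div_eq_mul_inv] at this
  have h3 := HasDerivAt.scomp r (hasDerivAt_gaussTransform hU hs1 h4) h1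
  refine (h2.smul h3).congr_deriv ?_
  generalize r ^ (s - 1) = q
  simp only [Function.comp_apply, smul_neg, smul_add, smul_smul, ← neg_smul]
  rw [add_comm]
  congr 2
  · field_simp
  · field_simp

variable [CompleteSpace H]

theorem integral_rpow_smul_weakDeriv {U U' : ℝ → H} (hUU' : IsWeakDeriv U U')
    (hU : MemLp (fun t : ℝ => t ^ (1 / 2 - s) • U t) 2 (volume.restrict (Ioi 0)))
    (hU' : MemLp (fun t : ℝ => t ^ (1 / 2 - s) • U' t) 2 (volume.restrict (Ioi 0)))
    (hs0 : 0 < s) (hs1 : s < 1) {x : H} (hx : IsTraceAtZero U x) {b : ℝ} (hb : 0 < b) :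
    ∫ t in Ioi (0 : ℝ), (t ^ (2 - 2 * s) * Real.exp (-b * t ^ 2)) • U' t =
      -((2 - 2 * s) • gaussTransform s U b) + (2 * b) •
        ∫ t in Ioi (0 : ℝ), (t ^ (3 - 2 * s) * Real.exp (-b * t ^ 2)) • U t := by
  have hd : ∀ t ∈ Ioi (0 : ℝ),
      deriv (fun t : ℝ => t ^ (2 - 2 * s) * Real.exp (-b * t ^ 2)) t • U t =
        (2 - 2 * s) • (t ^ (1 - 2 * s) * Real.exp (-b * t ^ 2)) • U t -
          (2 * b) • (t ^ (3 - 2 * s) * Real.exp (-b * t ^ 2)) • U t := fun t ht => by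
    rw [deriv_rpow_mul_exp_neg_mul_sq _ _ ht, sub_smul, mul_smul (2 - 2 * s), mul_smul (2 * b),
      show 2 - 2 * s - 1 = 1 - 2 * s by ring, show 2 - 2 * s + 1 = 3 - 2 * s by ring]
  have i1 := integrableOn_rpow_mul_exp_smul hU (a := 1 - 2 * s) (by linarith) hb
  have i3 := integrableOn_rpow_mul_exp_smul hU (a := 3 - 2 * s) (by linarith) hb
  have i1' : IntegrableOn (fun t : ℝ =>
    (2 - 2 * s) • (t ^ (1 - 2 * s) * Real.exp (-b * t ^ 2)) • U t) (Ioi 0) := i1.smul _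
  have i3' : IntegrableOn (fun t : ℝ =>
    (2 * b) • (t ^ (3 - 2 * s) * Real.exp (-b * t ^ 2)) • U t) (Ioi 0) := i3.smul _
  have hp0 : Tendsto (fun t : ℝ => t ^ (2 - 2 * s) * Real.exp (-b * t ^ 2)) (𝓝[>] 0) (𝓝 0) := by
    have hc : ContinuousAt (fun t : ℝ => t ^ (2 - 2 * s) * Real.exp (-b * t ^ 2)) 0 :=
      (Real.continuousAt_rpow_const _ _ (Or.inr (by linarith))).mul (by fun_prop)
    have := hc.tendsto.mono_left (nhdsWithin_le_nhds (s := Ioi 0))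
    simpa [Real.zero_rpow (by linarith : 2 - 2 * s ≠ 0)] using this
  have h := hUU'.integral_smul_eq_sub hx (contDiffOn_rpow_mul_exp_neg_mul_sq _ b) hp0
    (integrableOn_rpow_mul_exp_smul hU' (by linarith) hb)
    (integrableOn_rpow_mul_exp_smul hU (by linarith) hb)
    (IntegrableOn.congr_fun (i1'.sub i3') (fun t ht => (hd t ht).symm) measurableSet_Ioi)
  rw [h, setIntegral_congr_fun measurableSet_Ioi hd, integral_sub i1' i3', integral_smul,
    integral_smul, zero_smul, gaussTransform]
  abel

/-- The equation `(t ^ (1-2s) T U')' = t ^ (1-2s) U`, tested with the Gaussian `e^(-b t²)`. -/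
theorem gaussTransform_eq {U U' : ℝ → H} {T : H →L[ℂ] H} {x η : H} (hUU' : IsWeakDeriv U U')
    (hU : MemLp (fun t : ℝ => t ^ (1 / 2 - s) • U t) 2 (volume.restrict (Ioi 0)))
    (hU' : MemLp (fun t : ℝ => t ^ (1 / 2 - s) • U' t) 2 (volume.restrict (Ioi 0)))
    (hs0 : 0 < s) (hs1 : s < 1) (hx : IsTraceAtZero U x)
    (hw : IsWeakDeriv (fun t => T (t ^ (1 - 2 * s) • U' t)) fun t => t ^ (1 - 2 * s) • U t)
    (hη : IsTraceAtZero (fun t => T (t ^ (1 - 2 * s) • U' t)) (-η)) {b : ℝ} (hb : 0 < b) :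
    gaussTransform s U b = η + (2 * b) • T (-((2 - 2 * s) • gaussTransform s U b) + (2 * b) •
        ∫ t in Ioi (0 : ℝ), (t ^ (3 - 2 * s) * Real.exp (-b * t ^ 2)) • U t) := by
  have hd : ∀ t : ℝ, deriv (fun t : ℝ => Real.exp (-b * t ^ 2)) t =
      Real.exp (-b * t ^ 2) * (-b * (2 * t)) := fun t => by
    have h2 : HasDerivAt (fun t : ℝ => Real.exp (-b * t ^ 2))
        (Real.exp (-b * t ^ 2) * (-b * (2 * t))) t := by
      simpa using ((hasDerivAt_pow 2 t).const_mul (-b)).exp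
    exact h2.deriv
  have iU' : ∀ a, -s < a → IntegrableOn
      (fun t : ℝ => (t ^ a * Real.exp (-b * t ^ 2)) • U' t) (Ioi 0) := fun a ha =>
    integrableOn_rpow_mul_exp_smul hU' ha hb
  have e1 : ∀ t : ℝ, Real.exp (-b * t ^ 2) • t ^ (1 - 2 * s) • U t =
      (t ^ (1 - 2 * s) * Real.exp (-b * t ^ 2)) • U t := fun t => by rw [smul_smul, mul_comm]
  have e2 : ∀ t : ℝ, Real.exp (-b * t ^ 2) • T (t ^ (1 - 2 * s) • U' t) =
      T ((t ^ (1 - 2 * s) * Real.exp (-b * t ^ 2)) • U' t) := fun t => by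
    rw [← ContinuousLinearMap.map_smul_of_tower, smul_smul, mul_comm]
  have e3 : ∀ t ∈ Ioi (0 : ℝ),
      deriv (fun t : ℝ => Real.exp (-b * t ^ 2)) t • T (t ^ (1 - 2 * s) • U' t) =
      (-(2 * b)) • T ((t ^ (2 - 2 * s) * Real.exp (-b * t ^ 2)) • U' t) := fun t ht => by
    rw [hd, ← ContinuousLinearMap.map_smul_of_tower, ← ContinuousLinearMap.map_smul_of_tower,
      smul_smul, smul_smul, show 2 - 2 * s = 1 - 2 * s + 1 by ring,
      Real.rpow_add_one (ne_of_gt ht)]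
    ring_nf
  have i3 : IntegrableOn (fun t : ℝ =>
      (-(2 * b)) • T ((t ^ (2 - 2 * s) * Real.exp (-b * t ^ 2)) • U' t)) (Ioi 0) :=
    (T.integrable_comp (iU' _ (by linarith))).smul _
  have hp0 : Tendsto (fun t : ℝ => Real.exp (-b * t ^ 2)) (𝓝[>] 0) (𝓝 1) := by
    have hc : Continuous (fun t : ℝ => Real.exp (-b * t ^ 2)) := by fun_prop
    simpa using (hc.tendsto 0).mono_left (nhdsWithin_le_nhds (s := Ioi 0))
  have h := hw.integral_smul_eq_sub hη (p := fun t => Real.exp (-b * t ^ 2))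
    (ContDiff.contDiffOn (by fun_prop)) hp0
    (by simp only [e1]; exact integrableOn_rpow_mul_exp_smul hU (by linarith) hb)
    (by simp only [e2]; exact T.integrable_comp (iU' _ (by linarith)))
    (IntegrableOn.congr_fun i3 (fun t ht => (e3 t ht).symm) measurableSet_Ioi)
  rw [setIntegral_congr_fun measurableSet_Ioi e3, integral_smul, T.integral_comp_comm
    (iU' _ (by linarith)), integral_rpow_smul_weakDeriv hUU' hU hU' hs0 hs1 hx hb] at h
  simp only [e1] at h
  refine h.trans ?_
  rw [one_smul, sub_neg_eq_add, neg_smul, neg_neg, add_comm]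

/-- The heat transform `v` satisfies `T v' = v - r ^ (s-1) η`. -/
theorem apply_deriv_heatTransform {U U' : ℝ → H} {T : H →L[ℂ] H} {x η : H}
    (hUU' : IsWeakDeriv U U')
    (hU : MemLp (fun t : ℝ => t ^ (1 / 2 - s) • U t) 2 (volume.restrict (Ioi 0)))
    (hU' : MemLp (fun t : ℝ => t ^ (1 / 2 - s) • U' t) 2 (volume.restrict (Ioi 0)))
    (hs0 : 0 < s) (hs1 : s < 1) (hx : IsTraceAtZero U x)
    (hw : IsWeakDeriv (fun t => T (t ^ (1 - 2 * s) • U' t)) fun t => t ^ (1 - 2 * s) • U t)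
    (hη : IsTraceAtZero (fun t => T (t ^ (1 - 2 * s) • U' t)) (-η)) {r : ℝ} (hr : 0 < r) :
    T ((r ^ (s - 1) * r⁻¹) • ((s - 1) • gaussTransform s U (4 * r)⁻¹ + (4 * r)⁻¹ •
        ∫ t in Ioi (0 : ℝ), (t ^ (3 - 2 * s) * Real.exp (-(4 * r)⁻¹ * t ^ 2)) • U t)) =
      heatTransform s U r - r ^ (s - 1) • η := by
  have h4 : 0 < (4 * r)⁻¹ := by positivity
  have h := gaussTransform_eq hUU' hU hU' hs0 hs1 hx hw hη h4
  rw [heatTransform, ← smul_sub, sub_eq_of_eq_add' h,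
    ← ContinuousLinearMap.map_smul_of_tower, ← ContinuousLinearMap.map_smul_of_tower]
  congr 1
  simp only [smul_add, smul_smul, ← neg_smul]
  congr 2
  · field_simp; ring
  · field_simp; norm_num

/-- As `r ↓ 0` the heat kernel concentrates at `t = 0`; its total mass for `t ^ (1-2s) dt` is the
constant in the limit. -/
theorem tendsto_heatTransform {U : ℝ → H}
    (hU : MemLp (fun t : ℝ => t ^ (1 / 2 - s) • U t) 2 (volume.restrict (Ioi 0)))
    (hs1 : s < 1) {x : H} (hx : IsTraceAtZero U x) :
    Tendsto (heatTransform s U) (𝓝[>] 0)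
      (𝓝 ((4 ^ (1 - s) * (1 / 2 * Real.Gamma (1 - s))) • x)) := by
  obtain ⟨c, -, hcU, hcx⟩ := hx
  set κ := 4 ^ (1 - s) * (1 / 2 * Real.Gamma (1 - s)) with hκ
  have hΓ : 0 < Real.Gamma (1 - s) := Real.Gamma_pos_of_pos (by linarith)
  have hκ0 : 0 < κ := by positivity
  have ik : ∀ b : ℝ, 0 < b →
      IntegrableOn (fun t : ℝ => t ^ (1 - 2 * s) * Real.exp (-b * t ^ 2)) (Ioi 0) := fun b hb =>
    integrableOn_rpow_mul_exp_neg_mul_sq hb (by linarith)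
  have iU : ∀ b : ℝ, 0 < b →
      IntegrableOn (fun t : ℝ => (t ^ (1 - 2 * s) * Real.exp (-b * t ^ 2)) • (U t - x)) (Ioi 0) :=
    fun b hb => by
      simp only [smul_sub]
      exact (integrableOn_rpow_mul_exp_smul hU (by linarith) hb).sub ((ik b hb).smul_const x)
  set K := ∫ t in Ioi (0 : ℝ), ‖(t ^ (1 - 2 * s) * Real.exp (-1 * t ^ 2)) • (U t - x)‖
  have hmass : ∀ r : ℝ, 0 < r →
      r ^ (s - 1) * ∫ t in Ioi (0 : ℝ), t ^ (1 - 2 * s) * Real.exp (-(4 * r)⁻¹ * t ^ 2) = κ :=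
    fun r hr => by
      rw [integral_rpow_mul_exp_neg_mul_sq hs1 (by positivity), ← mul_assoc,
        ← Real.mul_rpow hr.le (by positivity), hκ]
      congr 1
      rw [show r * (4 * r)⁻¹ = 4⁻¹ by field_simp, Real.inv_rpow (by norm_num),
        ← Real.rpow_neg (by norm_num)]
      ring_nf
  have hdiff : ∀ r : ℝ, 0 < r → heatTransform s U r - κ • x = r ^ (s - 1) •
      ∫ t in Ioi (0 : ℝ), (t ^ (1 - 2 * s) * Real.exp (-(4 * r)⁻¹ * t ^ 2)) • (U t - x) :=
    fun r hr => by
      have h4 : 0 < (4 * r)⁻¹ := by positivity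
      simp only [smul_sub]
      rw [integral_sub (integrableOn_rpow_mul_exp_smul hU (by linarith) h4)
        ((ik _ h4).smul_const x), integral_smul_const, smul_sub, smul_smul, hmass r hr]
      rfl
  have hdecay : ∀ δ : ℝ, 0 < δ →
      Tendsto (fun r : ℝ => r ^ (s - 1) * Real.exp (-((4 * r)⁻¹ - 1) * δ ^ 2) * K) (𝓝[>] 0)
        (𝓝 0) := fun δ hδ => by
    have h1 := (tendsto_rpow_mul_exp_neg_mul_atTop_nhds_zero (1 - s) (δ ^ 2 / 4)
      (by positivity)).comp tendsto_inv_nhdsGT_zero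
    have h2 := h1.mul_const (Real.exp (δ ^ 2) * K)
    rw [zero_mul] at h2
    refine h2.congr' ?_
    filter_upwards [self_mem_nhdsWithin] with r hr
    rw [mem_Ioi] at hr
    simp only [Function.comp_apply]
    rw [Real.inv_rpow hr.le, ← Real.rpow_neg hr.le, neg_sub, ← mul_assoc, mul_assoc (r ^ (s - 1)),
      ← Real.exp_add]
    congr 3
    field_simp
    ring
  -- `‖U - x‖` is small on `(0, δ)`, and the kernel is uniformly small beyond `δ`
  rw [Metric.tendsto_nhds]
  intro ε hε
  obtain ⟨δ, hδ, hδc⟩ := mem_nhdsGT_iff_exists_Ioo_subset.1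
    ((Metric.tendsto_nhds.1 hcx) (ε / (2 * κ)) (by positivity))
  rw [mem_Ioi] at hδ
  have hr14 : ∀ᶠ r in 𝓝[>] (0 : ℝ), r < 1 / 4 := nhdsWithin_le_nhds (Iio_mem_nhds (by norm_num))
  filter_upwards [self_mem_nhdsWithin, hr14,
    (hdecay δ hδ).eventually_lt_const (half_pos hε)] with r hr hr4 hsmall
  rw [mem_Ioi] at hr
  have h4 : 0 < (4 * r)⁻¹ := by positivity
  have h41 : 1 ≤ (4 * r)⁻¹ := (one_le_inv₀ (by positivity)).2 (by linarith)
  have hrp : 0 < r ^ (s - 1) := Real.rpow_pos_of_pos hr _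
  have hbound : ‖∫ t in Ioi (0 : ℝ),
      (t ^ (1 - 2 * s) * Real.exp (-(4 * r)⁻¹ * t ^ 2)) • (U t - x)‖ ≤
      (ε / (2 * κ)) * (∫ t in Ioi (0 : ℝ), t ^ (1 - 2 * s) * Real.exp (-(4 * r)⁻¹ * t ^ 2)) +
        Real.exp (-((4 * r)⁻¹ - 1) * δ ^ 2) * K := by
    have i1 := (ik _ h4).const_mul (ε / (2 * κ))
    have i2 := (iU 1 one_pos).norm.const_mul (Real.exp (-((4 * r)⁻¹ - 1) * δ ^ 2))
    rw [← integral_const_mul, ← integral_const_mul, ← integral_add i1 i2]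
    refine norm_integral_le_of_norm_le (i1.add i2) ?_
    filter_upwards [ae_restrict_mem measurableSet_Ioi, hcU] with t ht hcUt
    rw [mem_Ioi] at ht
    have htp : 0 < t ^ (1 - 2 * s) := Real.rpow_pos_of_pos ht _
    rw [norm_smul, norm_smul, Real.norm_of_nonneg (by positivity),
      Real.norm_of_nonneg (by positivity)]
    rcases lt_or_ge t δ with htδ | htδ
    · have h5 : ‖U t - x‖ ≤ ε / (2 * κ) := by
        have := hδc ⟨ht, htδ⟩
        rw [mem_ofPred_eq, dist_eq_norm, hcUt] at this
        exact this.le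
      have h6 := mul_le_mul_of_nonneg_left h5
        (by positivity : 0 ≤ t ^ (1 - 2 * s) * Real.exp (-(4 * r)⁻¹ * t ^ 2))
      refine h6.trans ?_
      rw [mul_comm (_ * _) (ε / (2 * κ))]
      exact le_add_of_nonneg_right (by positivity)
    · have h5 : Real.exp (-(4 * r)⁻¹ * t ^ 2) ≤
          Real.exp (-((4 * r)⁻¹ - 1) * δ ^ 2) * Real.exp (-1 * t ^ 2) := by
        rw [← Real.exp_add]
        refine Real.exp_le_exp.2 ?_
        have : δ ^ 2 ≤ t ^ 2 := by gcongr
        nlinarith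
      refine le_add_of_nonneg_of_le (by positivity) ?_
      calc t ^ (1 - 2 * s) * Real.exp (-(4 * r)⁻¹ * t ^ 2) * ‖U t - x‖
          ≤ t ^ (1 - 2 * s) * (Real.exp (-((4 * r)⁻¹ - 1) * δ ^ 2) * Real.exp (-1 * t ^ 2)) *
            ‖U t - x‖ := by gcongr
        _ = _ := by ring
  rw [dist_eq_norm, hdiff r hr, norm_smul, Real.norm_of_nonneg hrp.le]
  refine (mul_le_mul_of_nonneg_left hbound hrp.le).trans_lt ?_
  rw [mul_add, mul_left_comm, hmass r hr, ← mul_assoc (r ^ (s - 1))]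
  have : ε / (2 * κ) * κ = ε / 2 := by field_simp
  linarith

end Gaussian

/-! ### Square integrability for the measure `dt / t` -/

/-- Square integrability against `dt / t` amounts to square integrability against `dt` with half a
power less. -/
theorem memLp_restrict_of_memLp_starMeasure {X : Type*} [NormedAddCommGroup X] [NormedSpace ℂ X]
    {f : ℝ → X} (hf : AEStronglyMeasurable f (volume.restrict (Ioi 0))) {a : ℝ}
    (h : MemLp (fun t => (t ^ a : ℝ) • f t) 2 starMeasure) :
    MemLp (fun t => (t ^ (a - 1 / 2) : ℝ) • f t) 2 (volume.restrict (Ioi 0)) := by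
  have hpow : ContinuousOn (fun t : ℝ => t ^ (a - 1 / 2)) (Ioi 0) := fun t ht =>
    (Real.continuousAt_rpow_const _ _ (Or.inl (ne_of_gt ht))).continuousWithinAt
  have hm : AEStronglyMeasurable (fun t => (t ^ (a - 1 / 2) : ℝ) • f t) (volume.restrict (Ioi 0)) :=
    (hpow.aestronglyMeasurable measurableSet_Ioi).smul hf
  rw [memLp_two_iff_integrable_sq_norm hm]
  have h1 := (memLp_two_iff_integrable_sq_norm h.aestronglyMeasurable).1 h
  rw [starMeasure, integrable_withDensity_iff (by fun_prop)
    (Eventually.of_forall fun t => ENNReal.ofReal_lt_top)] at h1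
  refine IntegrableOn.congr_fun h1 (fun t ht => ?_) measurableSet_Ioi
  rw [mem_Ioi] at ht
  have h2 : t ^ a = t ^ (a - 1 / 2) * t ^ (1 / 2 : ℝ) := by
    rw [← Real.rpow_add ht]; ring_nf
  have h3 : (t ^ (1 / 2 : ℝ)) ^ 2 = t := by
    rw [← Real.rpow_natCast, ← Real.rpow_mul ht.le]; norm_num
  rw [norm_smul, norm_smul, ENNReal.toReal_ofReal (inv_pos.2 ht).le, h2, norm_mul, mul_pow, mul_pow,
    mul_pow, Real.norm_of_nonneg (Real.rpow_nonneg ht.le (1 / 2)), h3]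
  field_simp

/-! ### The operator associated with a coercive form -/

section Forms

variable {V H : Type*} [NormedAddCommGroup V] [InnerProductSpace ℂ V]
  [NormedAddCommGroup H] [InnerProductSpace ℂ H]

/-- The Fréchet–Riesz theorem for the antidual. -/
theorem exists_rieszAntidual (V : Type*) [NormedAddCommGroup V] [InnerProductSpace ℂ V]
    [CompleteSpace V] : ∃ J : Antidual V →L[ℂ] V, (∀ F v, inner ℂ v (J F) = F v) := by
  let R : V →L[ℂ] Antidual V := toAntidual (ContinuousLinearMap.id ℂ V)
  have hR : ∀ a v, R a v = inner ℂ v a := fun a v => rfl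
  have hker : R.ker = ⊥ := by
    rw [LinearMap.ker_eq_bot']
    intro a ha
    have : R a a = 0 := by
      change R a = 0 at ha
      rw [ha]; rfl
    rw [hR] at this
    exact inner_self_eq_zero.1 this
  have hrange : R.range = ⊤ := by
    rw [LinearMap.range_eq_top]
    intro F
    let G : StrongDual ℂ V := ((starL ℂ : ℂ ≃L⋆[ℂ] ℂ) : ℂ →L⋆[ℂ] ℂ).comp F
    refine ⟨(InnerProductSpace.toDual ℂ V).symm G, ContinuousLinearMap.ext fun v => ?_⟩
    have h1 : inner ℂ ((InnerProductSpace.toDual ℂ V).symm G) v = G v :=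
      InnerProductSpace.toDual_symm_apply
    change inner ℂ v ((InnerProductSpace.toDual ℂ V).symm G) = F v
    rw [← inner_conj_symm, h1]
    exact star_star (F v)
  let e := ContinuousLinearEquiv.ofBijective R hker hrange
  refine ⟨e.symm, fun F v => ?_⟩
  rw [← hR]
  exact DFunLike.congr_fun (e.apply_symm_apply F) v

/-- The Lax–Milgram theorem: the operator `𝒜 : V → V'` of a coercive form is invertible. -/
theorem Coercive.exists_inverse [CompleteSpace V] {ℰ : V →L[ℂ] Antidual V} (h : Coercive ℰ) :
    ∃ S : Antidual V →L[ℂ] V, (∀ F, ℰ (S F) = F) ∧ ∀ u, S (ℰ u) = u := by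
  obtain ⟨μ, hμ, hcoer⟩ := h
  obtain ⟨J, hJ⟩ := exists_rieszAntidual V
  obtain ⟨R, hR, hR'⟩ := exists_inverse_of_coercive (J ∘L ℰ) hμ fun v => by
    have h1 := hcoer v
    rw [← hJ, ← inner_conj_symm, Complex.conj_re] at h1
    exact h1
  refine ⟨R ∘L J, fun F => ContinuousLinearMap.ext fun v => ?_, fun u => hR' u⟩
  rw [← hJ, ← hJ]
  exact congrArg _ (hR (J F))

variable {ι : V →L[ℂ] H} {ℰ : V →L[ℂ] Antidual V} {S : Antidual V →L[ℂ] V}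

theorem toAntidual_injective (hdense : DenseRange ι) : Function.Injective (toAntidual ι) := by
  rw [injective_iff_map_eq_zero]
  intro f hf
  refine hdense.eq_zero_of_inner_right ℂ fun v => ?_
  rw [← toAntidual_apply, hf]
  rfl

/-- The inverse `T` of the operator associated with a coercive form is strictly accretive. -/
theorem exists_mul_norm_sq_le_re_inner (hℰ : Coercive ℰ) (hS : ∀ F, ℰ (S F) = F) :
    ∃ δ : ℝ, 0 < δ ∧ ∀ f : H, δ * ‖(ι ∘L S ∘L toAntidual ι) f‖ ^ 2 ≤
      (inner ℂ ((ι ∘L S ∘L toAntidual ι) f) f).re := by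
  obtain ⟨μ, hμ, hcoer⟩ := hℰ
  refine ⟨μ / (‖ι‖ ^ 2 + 1), by positivity, fun f => ?_⟩
  have h1 := hcoer (S (toAntidual ι f))
  rw [hS, toAntidual_apply] at h1
  refine le_trans ?_ h1
  have h2 : ‖ι (S (toAntidual ι f))‖ ^ 2 ≤ ‖ι‖ ^ 2 * ‖S (toAntidual ι f)‖ ^ 2 := by
    rw [← mul_pow]
    exact pow_le_pow_left₀ (norm_nonneg _) (ι.le_opNorm _) 2
  rw [div_mul_eq_mul_div, div_le_iff₀ (by positivity), mul_assoc]
  refine mul_le_mul_of_nonneg_left ?_ hμ.le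
  change ‖ι (S (toAntidual ι f))‖ ^ 2 ≤ _
  nlinarith [sq_nonneg ‖S (toAntidual ι f)‖]

/-- The graph of the operator associated with the form is the transposed graph of `T`. -/
theorem mem_partGraph_iff (hS : ∀ F, ℰ (S F) = F) (hS' : ∀ u, S (ℰ u) = u) {p : H × H} :
    p ∈ partGraph ι ℰ ↔ (ι ∘L S ∘L toAntidual ι) p.2 = p.1 := by
  constructor
  · rintro ⟨u, hu, hu'⟩
    rw [← hu, ← hS' u, hu']
    rfl
  · exact fun h => ⟨S (toAntidual ι p.2), h, hS _⟩

theorem mem_graph_formOperator_iff (hι : Function.Injective ι) (hdense : DenseRange ι)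
    (hS : ∀ F, ℰ (S F) = F) (hS' : ∀ u, S (ℰ u) = u) {p : H × H} :
    p ∈ (formOperator ι ℰ).graph ↔ (ι ∘L S ∘L toAntidual ι) p.2 = p.1 := by
  rw [formOperator, Submodule.toLinearPMap_graph_eq, mem_partGraph_iff hS hS']
  rintro q ⟨u, hu, hu'⟩ hq
  rw [hq] at hu
  have hu0 : u = 0 := hι (by rw [hu, map_zero])
  rw [hu0, map_zero] at hu'
  exact toAntidual_injective hdense (by rw [← hu', map_zero])

theorem IsBoundedInverse.unique {B : H →ₗ.[ℂ] H} {R R' : H →L[ℂ] H} (h : IsBoundedInverse B R)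
    (h' : IsBoundedInverse B R') : R = R' := by
  ext f
  obtain ⟨hd, hB⟩ := h.1 f
  have h1 := h'.2 ⟨R f, hd⟩
  rw [hB] at h1
  exact h1.symm

theorem boundedInverse_eq {B : H →ₗ.[ℂ] H} {R : H →L[ℂ] H} (h : IsBoundedInverse B R) :
    boundedInverse B = R := by
  have hex : ∃ R : H →L[ℂ] H, IsBoundedInverse B R := ⟨R, h⟩
  rw [boundedInverse, dif_pos hex]
  exact hex.choose_spec.unique h

theorem shift_apply (A : H →ₗ.[ℂ] H) (r : ℝ) (x : A.domain) :
    shift A r x = r • (x : H) + A x := rfl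

theorem boundedInverse_shift [CompleteSpace H] {A : H →ₗ.[ℂ] H} {T : H →L[ℂ] H}
    (hA : ∀ p : H × H, p ∈ A.graph ↔ T p.2 = p.1) (hacc : ∀ f, 0 ≤ (inner ℂ (T f) f).re) {r : ℝ}
    (hr : 0 ≤ r) : boundedInverse (shift A r) = T ∘L dampedInverse T r := by
  refine boundedInverse_eq ⟨fun f => ?_, fun x => ?_⟩
  · have h1 : ((T ∘L dampedInverse T r) f, dampedInverse T r f) ∈ A.graph := (hA _).2 rfl
    obtain ⟨x, hx, hx'⟩ := (LinearPMap.mem_graph_iff A).1 h1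
    change (x : H) = (T ∘L dampedInverse T r) f at hx
    have hd : (T ∘L dampedInverse T r) f ∈ A.domain := by rw [← hx]; exact x.2
    refine ⟨hd, ?_⟩
    have e : x = ⟨_, hd⟩ := Subtype.ext hx
    refine (shift_apply A r ⟨_, hd⟩).trans ?_
    rw [← e, hx', hx, add_comm]
    exact dampedInverse_add hacc hr f
  · have h1 := (hA _).1 (A.mem_graph ⟨x, x.2⟩)
    change T (A ⟨x, x.2⟩) = x at h1
    change T (dampedInverse T r (r • (x : H) + A ⟨x, x.2⟩)) = x
    generalize A ⟨x, x.2⟩ = g at h1 ⊢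
    rw [← h1, add_comm, dampedInverse_apply_add hacc hr]

theorem negFracPow_eq_balakrishnan [CompleteSpace H] {A : H →ₗ.[ℂ] H} {T : H →L[ℂ] H}
    (hA : ∀ p : H × H, p ∈ A.graph ↔ T p.2 = p.1) (hacc : ∀ f, 0 ≤ (inner ℂ (T f) f).re) (s : ℝ) :
    negFracPow A s = (Real.sin (Real.pi * s) / Real.pi) • balakrishnan T s := by
  rw [negFracPow, balakrishnan]
  congr 1
  exact setIntegral_congr_fun measurableSet_Ioi fun r hr => by
    simp only [boundedInverse_shift hA hacc (le_of_lt hr)]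

theorem mem_domain_fracPow_iff {A : H →ₗ.[ℂ] H} {s : ℝ} {x : H} :
    x ∈ (fracPow A s).domain ↔ ∃ f, negFracPow A s f = x := by
  rw [fracPow, LinearPMap.inverse_domain]
  exact ⟨fun ⟨f, hf⟩ => ⟨f, hf⟩, fun ⟨f, hf⟩ => ⟨⟨f, trivial⟩, hf⟩⟩

end Forms

/-! ### The Dirichlet and Neumann data of a harmonic function -/

variable {V H : Type*} [NormedAddCommGroup V] [InnerProductSpace ℂ V]
  [NormedAddCommGroup H] [InnerProductSpace ℂ H] [CompleteSpace H]
  {ι : V →L[ℂ] H} {ℰ : V →L[ℂ] Antidual V} {S : Antidual V →L[ℂ] V} {s : ℝ} {u : ℝ → V} {x : H}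
  {y : Antidual V}

/-- The Dirichlet-to-Neumann relation, transported to `H` by `𝒜⁻¹ : V' → V ⊆ H`: up to a positive
factor, `A⁻¹ x = A⁻ˢ 𝒜⁻¹ y`. -/
theorem IsHarmonic.smul_apply_trace_eq (hu : IsHarmonic ι ℰ s u) (hs0 : 0 < s) (hs1 : s < 1)
    {δ : ℝ} (hδ : 0 < δ)
    (hT : ∀ f : H, δ * ‖(ι ∘L S ∘L toAntidual ι) f‖ ^ 2 ≤
      (inner ℂ ((ι ∘L S ∘L toAntidual ι) f) f).re)
    (hS' : ∀ u, S (ℰ u) = u) (hx : IsTraceAtZero (fun t => ι (u t)) x)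
    (hy : IsNormalDeriv ι s u y) :
    (Real.Gamma (1 - s) * (4 ^ (1 - s) * (1 / 2 * Real.Gamma (1 - s)))) •
      (ι ∘L S ∘L toAntidual ι) x = balakrishnan (ι ∘L S ∘L toAntidual ι) s (ι (S y)) := by
  set T : H →L[ℂ] H := ι ∘L S ∘L toAntidual ι
  -- the weak derivatives `u₁`, `u₂`, `u₃` of `u` agree almost everywhere
  obtain ⟨⟨hu_loc, hu_L2, u₁, hu₁, hu₁_L2⟩, u₂, hu₂, -, w', hw', heq⟩ := hu
  obtain ⟨u₃, hu₃, htr⟩ := hy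
  have hexp : 1 / 2 - s = (1 - s) - 1 / 2 := by ring
  have hU : MemLp (fun t : ℝ => t ^ (1 / 2 - s) • ι (u t)) 2 (volume.restrict (Ioi 0)) := by
    rw [hexp]
    refine memLp_restrict_of_memLp_starMeasure hu₁.1.aestronglyMeasurable ?_
    simpa only [Function.comp_def, ContinuousLinearMap.map_smul_of_tower] using ι.comp_memLp' hu_L2
  have hU' : MemLp (fun t : ℝ => t ^ (1 / 2 - s) • u₂ t) 2 (volume.restrict (Ioi 0)) := by
    have h := memLp_restrict_of_memLp_starMeasure hu₁.2.1.aestronglyMeasurable hu₁_L2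
    rw [← hexp] at h
    refine h.ae_eq ?_
    filter_upwards [hu₁.ae_unique hu₂] with t ht
    rw [ht]
  -- the equation in `V'`, with `𝒜⁻¹` applied
  have hw : IsWeakDeriv (fun t => T (t ^ (1 - 2 * s) • u₂ t))
      fun t => t ^ (1 - 2 * s) • ι (u t) := by
    refine (hw'.comp_clm (ι ∘L S)).congr_right ?_
    filter_upwards [heq] with t ht
    rw [neg_add_eq_zero.1 ht, ContinuousLinearMap.map_smul_of_tower]
    change t ^ (1 - 2 * s) • ι (S (ℰ (u t))) = _
    rw [hS']
  have hη : IsTraceAtZero (fun t => T (t ^ (1 - 2 * s) • u₂ t)) (-ι (S y)) := by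
    have h := htr.comp_clm (-(ι ∘L S))
    refine IsTraceAtZero.congr h ?_
    filter_upwards [hu₃.ae_unique hu₂] with t ht
    rw [ht, neg_apply, map_neg, neg_neg]
    rfl
  obtain ⟨C, hC⟩ := exists_norm_heatTransform_le hU hs1
  have h := apply_eq_balakrishnan_of_tendsto hδ hT hs0 hs1
    (fun r hr => hasDerivAt_heatTransform hU hs1 hr)
    (fun r hr => apply_deriv_heatTransform hu₂ hU hU' hs0 hs1 hx hw hη hr) hC
    (tendsto_heatTransform hU hs1 hx)
  rwa [ContinuousLinearMap.map_smul_of_tower, smul_smul] at h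

end FracDtN

theorem mainTheorem5 {V H : Type*}
    [NormedAddCommGroup V] [InnerProductSpace ℂ V] [CompleteSpace V]
    [NormedAddCommGroup H] [InnerProductSpace ℂ H] [CompleteSpace H]
    (ι : V →L[ℂ] H) (hι : Function.Injective ι) (hdense : DenseRange ι)
    (ℰ : V →L[ℂ] FracDtN.Antidual V) (hℰ : FracDtN.Coercive ℰ)
    (s : ℝ) (hs0 : 0 < s) (hs1 : s < 1)
    (u : ℝ → V) (hu : FracDtN.IsHarmonic ι ℰ s u)
    (x : H) (hx : FracDtN.IsTraceAtZero (fun t => ι (u t)) x)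
    (y : FracDtN.Antidual V) (hy : FracDtN.IsNormalDeriv ι s u y) :
    x ∈ (FracDtN.fracPow (FracDtN.formOperator ι ℰ) s).domain ↔
      ∃ f : H, FracDtN.toAntidual ι f = y := by
  obtain ⟨S, hS, hS'⟩ := hℰ.exists_inverse
  obtain ⟨δ, hδ, hT⟩ := FracDtN.exists_mul_norm_sq_le_re_inner (ι := ι) hℰ hS
  have hkey := hu.smul_apply_trace_eq hs0 hs1 hδ hT hS' hx hy
  have hA : ∀ p : H × H, p ∈ (FracDtN.formOperator ι ℰ).graph ↔ _ := fun p =>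
    FracDtN.mem_graph_formOperator_iff hι hdense hS hS'
  have hιS : Function.Injective fun F => ι (S F) :=
    hι.comp (Function.LeftInverse.injective hS)
  have hTinj : Function.Injective (ι ∘L S ∘L FracDtN.toAntidual ι) :=
    hιS.comp (FracDtN.toAntidual_injective hdense)
  have hTj : ∀ f, (ι ∘L S ∘L FracDtN.toAntidual ι) f = ι (S (FracDtN.toAntidual ι f)) :=
    fun f => rfl
  have hacc : ∀ f, 0 ≤ (inner ℂ ((ι ∘L S ∘L FracDtN.toAntidual ι) f) f).re := fun f =>
    (by positivity : (0 : ℝ) ≤ _).trans (hT f)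
  rw [FracDtN.mem_domain_fracPow_iff, FracDtN.negFracPow_eq_balakrishnan hA hacc]
  have hB := FracDtN.balakrishnan_comm hacc hs0 hs1
  have hBinj := FracDtN.balakrishnan_injective hδ hT hTinj hs0 hs1
  have hσ : 0 < Real.sin (Real.pi * s) / Real.pi := div_pos
    (Real.sin_pos_of_pos_of_lt_pi (by positivity) (by nlinarith [Real.pi_pos])) Real.pi_pos
  have hΓ : 0 < Real.Gamma (1 - s) := Real.Gamma_pos_of_pos (by linarith)
  have hk : 0 < Real.Gamma (1 - s) * (4 ^ (1 - s) * (1 / 2 * Real.Gamma (1 - s))) := by positivity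
  generalize Real.sin (Real.pi * s) / Real.pi = σ at hσ
  generalize Real.Gamma (1 - s) * (4 ^ (1 - s) * (1 / 2 * Real.Gamma (1 - s))) = k at hk hkey
  generalize FracDtN.balakrishnan (ι ∘L S ∘L FracDtN.toAntidual ι) s = B at hkey hB hBinj
  constructor
  -- if `x = A⁻ˢ f`, then `A⁻ˢ η = k T A⁻ˢ f = A⁻ˢ (k T f)`, so that `η` is in the range of `T`
  · rintro ⟨f, rfl⟩
    refine ⟨(k * σ) • f, hιS (hBinj ?_)⟩
    change B (ι (S _)) = B (ι (S _))
    rw [← hkey, ← hTj, hB, smul_apply,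
      ContinuousLinearMap.map_smul_of_tower, ContinuousLinearMap.map_smul_of_tower,
      ContinuousLinearMap.map_smul_of_tower, smul_smul]
  -- if `η = T f`, then `k T x = A⁻ˢ T f = T A⁻ˢ f` and `T` can be cancelled
  · rintro ⟨f, rfl⟩
    refine ⟨(σ⁻¹ * k⁻¹) • f, ?_⟩
    rw [← hTj, hB, ← ContinuousLinearMap.map_smul_of_tower] at hkey
    rw [smul_apply, ContinuousLinearMap.map_smul_of_tower, smul_smul,
      ← hTinj hkey, smul_smul, mul_inv_cancel_left₀ hσ.ne', inv_mul_cancel₀ hk.ne', one_smul]
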